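/- Let $A$ be an artin algebra, i.e. an algebra that is finitely generated as a module over a commutative artinian ring. "Module" means left module, not necessarily finitely generated; right $A$-modules are left $A^{\mathrm{op}}$-modules. The algebra $A$ is Gorenstein if the regular modules ${}_AA$ and $A_A$ both have finite injective dimension; in that case $\mathrm{G.dim}\,A$ denotes the common value of $\mathrm{inj.dim}\,{}_AA$ and $\mathrm{inj.dim}\,A_A$. An acyclic complex $P^\bullet$ of projective $A$-modules is totally acyclic if $\mathrm{Hom}_A(P^\bullet,Q)$ is acyclic for every projective $A$-module $Q$. An $A$-module is Gorenstein-projective if it is isomorphic to the zeroth cocycle $Z^0(P^\bullet)$ of a totally acyclic complex $P^\bullet$. A proper Gorenstein-projective resolution of an $A$-module $M$ is an exact complex $\cdots\to G^{-1}\to G^0\to M\to 0$ with all $G^{-i}$ Gorenstein-projective that stays exact under $\mathrm{Hom}_A(G,-)$ for every Gorenstein-projective $G$; every module over an artin algebra has one, and it is unique up to homotopy equivalence. For an $A$-module $N$ let $\mathrm{Ext}^n_{\mathrm{GP}}(M,N)=H^n(\mathrm{Hom}_A(G^\bullet,N))$, and put $\mathrm{GP.dim}\,M=\sup\{n\ge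 0\mid \mathrm{Ext}^n_{\mathrm{GP}}(M,-)\ne 0\}$ and $\mathrm{gl.GP.dim}\,A=\sup_M \mathrm{GP.dim}\,M$, the supremum over all $A$-modules $M$. (All dimensions of a zero module are $\sup\emptyset=-\infty$, which counts as finite.) Then $A$ is Gorenstein if and only if $\mathrm{gl.GP.dim}\,A<\infty$. In this case $\mathrm{G.dim}\,A=\mathrm{gl.GP.dim}\,A$, that is, $\mathrm{inj.dim}\,{}_AA=\mathrm{inj.dim}\,A_A=\mathrm{gl.GP.dim}\,A$. -/

import Mathlib

open CategoryTheory

universe u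

/-- A totally acyclic complex of (arbitrary) `A`-modules: an acyclic complex `P` of projective
modules such that `Hom_A(P, Q)` is acyclic for every projective module `Q`.
Complexes indexed by `ℤ` are written homologically, with `P.X n` in cohomological degree `-n`. -/
structure IsTotallyAcyclic {A : Type u} [Ring A] (P : ChainComplex (ModuleCat.{u} A) ℤ) :
    Prop where
  projective (n : ℤ) : Projective (P.X n)
  acyclic : P.Acyclic
  acyclic_hom (Q : ModuleCat.{u} A) (hQ : Projective Q) : (P.linearYonedaObj ℤ Q).Acyclic

/-- A (not necessarily finitely generated) `A`-module is Gorenstein-projective if it is the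
kernel `Z_0(P) = ker (P_0 → P_{-1})` of the zeroth differential of a totally acyclic complex. -/
def IsGorensteinProjective {A : Type u} [Ring A] (M : ModuleCat.{u} A) : Prop :=
  ∃ P : ChainComplex (ModuleCat.{u} A) ℤ, IsTotallyAcyclic P ∧ Nonempty (P.cycles 0 ≅ M)

/-- A complex `X` of `A`-modules is right GP-acyclic if `Hom_A(G, X)` is acyclic for every
Gorenstein-projective module `G`. -/
def IsRightGPAcyclic {A : Type u} [Ring A] {ι : Type*} {c : ComplexShape ι}
    (X : HomologicalComplex (ModuleCat.{u} A) c) : Prop :=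
  ∀ G : ModuleCat.{u} A, IsGorensteinProjective G →
    (((preadditiveCoyoneda.obj (Opposite.op G)).mapHomologicalComplex c).obj X).Acyclic

/-- A proper Gorenstein-projective resolution `⋯ → G_2 → G_1 → G_0 → M → 0` of `M`. -/
structure ProperGPResolution {A : Type u} [Ring A] (M : ModuleCat.{u} A) where
  complex : ChainComplex (ModuleCat.{u} A) ℕ
  ε : complex.X 0 ⟶ M
  d_comp_ε : complex.d 1 0 ≫ ε = 0
  gorensteinProjective (n : ℕ) : IsGorensteinProjective (complex.X n)
  acyclic : (complex.augment ε d_comp_ε).Acyclic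
  proper : IsRightGPAcyclic (complex.augment ε d_comp_ε)

/-- The GP-extension group `Ext_GP^n(M, N) = H^n(Hom_A(G, N))`, computed by a proper
GP-resolution `G` of `M`. -/
noncomputable def ProperGPResolution.ext {A : Type u} [Ring A] {M : ModuleCat.{u} A}
    (G : ProperGPResolution M) (n : ℕ) (N : ModuleCat.{u} A) : ModuleCat.{u} ℤ :=
  (G.complex.linearYonedaObj ℤ N).homology n

theorem isZero_homology_linearYonedaObj_iff {A : Type u} [Ring A]
    (K : ChainComplex (ModuleCat.{u} A) ℕ) (N : ModuleCat.{u} A) (n : ℕ) :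
    Limits.IsZero ((K.linearYonedaObj ℤ N).homology n) ↔
      ∀ f : K.X n ⟶ N, K.d (n + 1) n ≫ f = 0 →
        ∃ g : K.X ((ComplexShape.down ℕ).next n) ⟶ N, K.d n _ ≫ g = f := by
  rw [← HomologicalComplex.exactAt_iff_isZero_homology,
    HomologicalComplex.exactAt_iff' _ ((ComplexShape.down ℕ).next n) n (n + 1) rfl (by simp),
    ShortComplex.moduleCat_exact_iff]
  rfl

namespace ProperGPResolution

variable {A : Type u} [Ring A] {M : ModuleCat.{u} A}

theorem exists_lift_zero (G : ProperGPResolution M) {X : ModuleCat.{u} A}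
    (hX : IsGorensteinProjective X) (f : X ⟶ M) :
    ∃ g : X ⟶ G.complex.X 0, g ≫ G.ε = f := by
  have h := G.proper X hX 0
  rw [HomologicalComplex.exactAt_iff' _ 1 0 0 (by simp) (by simp), ShortComplex.ab_exact_iff] at h
  exact h f (show f ≫ (0 : M ⟶ M) = 0 from Limits.comp_zero)

theorem exists_lift_one (G : ProperGPResolution M) {X : ModuleCat.{u} A}
    (hX : IsGorensteinProjective X) (f : X ⟶ G.complex.X 0) (hf : f ≫ G.ε = 0) :
    ∃ g : X ⟶ G.complex.X 1, g ≫ G.complex.d 1 0 = f := by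
  have h := G.proper X hX 1
  rw [HomologicalComplex.exactAt_iff' _ 2 1 0 (by simp) (by simp), ShortComplex.ab_exact_iff] at h
  exact h f hf

theorem exists_lift_succ (G : ProperGPResolution M) {X : ModuleCat.{u} A}
    (hX : IsGorensteinProjective X) (n : ℕ) (f : X ⟶ G.complex.X (n + 1))
    (hf : f ≫ G.complex.d (n + 1) n = 0) :
    ∃ g : X ⟶ G.complex.X (n + 2), g ≫ G.complex.d (n + 2) (n + 1) = f := by
  have h := G.proper X hX (n + 2)
  rw [HomologicalComplex.exactAt_iff' _ (n + 3) (n + 2) (n + 1) (by simp) (by simp),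
    ShortComplex.ab_exact_iff] at h
  exact h f hf

/-- Comparison theorem, existence. -/
theorem exists_lift (G G' : ProperGPResolution M) :
    ∃ φ : G.complex ⟶ G'.complex, φ.f 0 ≫ G'.ε = G.ε := by
  obtain ⟨g₀, h₀⟩ := G'.exists_lift_zero (G.gorensteinProjective 0) G.ε
  obtain ⟨g₁, h₁⟩ := G'.exists_lift_one (G.gorensteinProjective 1) (G.complex.d 1 0 ≫ g₀)
    (by rw [Category.assoc, h₀, G.d_comp_ε])
  refine ⟨ChainComplex.mkHom _ _ g₀ g₁ h₁ fun n p ↦ ?_, by simpa using h₀⟩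
  have := G'.exists_lift_succ (G.gorensteinProjective (n + 2)) n
    (G.complex.d (n + 2) (n + 1) ≫ p.2.1) (by simp [p.2.2])
  exact ⟨this.choose, this.choose_spec⟩

/-- Comparison theorem, uniqueness up to homotopy. -/
theorem nonempty_homotopy_zero (G G' : ProperGPResolution M) (φ : G.complex ⟶ G'.complex)
    (hφ : φ.f 0 ≫ G'.ε = 0) : Nonempty (Homotopy φ 0) := by
  obtain ⟨h₀, e₀⟩ := G'.exists_lift_one (G.gorensteinProjective 0) (φ.f 0) hφ
  obtain ⟨h₁, e₁⟩ := G'.exists_lift_succ (G.gorensteinProjective 1) 0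
    (φ.f 1 - G.complex.d 1 0 ≫ h₀) (by simp [e₀])
  refine ⟨Homotopy.mkInductive _ h₀ e₀.symm h₁ (by simp [e₁]) fun n p ↦ ?_⟩
  have := G'.exists_lift_succ (G.gorensteinProjective (n + 2)) (n + 1)
    (φ.f (n + 2) - G.complex.d (n + 2) (n + 1) ≫ p.2.1) (by simp [p.2.2])
  exact ⟨this.choose, by simp [this.choose_spec]⟩

/-- The vanishing of a GP-extension group does not depend on the proper GP-resolution. -/
theorem isZero_ext_iff (G G' : ProperGPResolution M) (n : ℕ) (N : ModuleCat.{u} A) :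
    Limits.IsZero (G.ext n N) ↔ Limits.IsZero (G'.ext n N) := by
  suffices H : ∀ G G' : ProperGPResolution M,
      Limits.IsZero (G'.ext n N) → Limits.IsZero (G.ext n N) from ⟨H G' G, H G G'⟩
  intro G G' h
  rw [ext, isZero_homology_linearYonedaObj_iff] at h ⊢
  intro f hf
  obtain ⟨φ, hφ⟩ := exists_lift G G'
  obtain ⟨ψ, hψ⟩ := exists_lift G' G
  obtain ⟨s⟩ := nonempty_homotopy_zero G G (φ ≫ ψ - 𝟙 _) (by simp [hφ, hψ])
  obtain ⟨g, hg⟩ := h (ψ.f n ≫ f) (by rw [← ψ.comm_assoc, hf, Limits.comp_zero])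
  have hs := s.comm n
  rw [prevD_eq s.hom (show (ComplexShape.down ℕ).Rel (n + 1) n from rfl)] at hs
  replace hs := congrArg (· ≫ f) hs
  simp [hf, dNext, sub_eq_iff_eq_add, ← hg] at hs
  refine ⟨φ.f _ ≫ g - s.hom _ n ≫ f, ?_⟩
  simp [hs]

end ProperGPResolution

/-- The Gorenstein-projective dimension `GP.dim M = sup {n ≥ 0 | Ext_GP^n(M, -) ≠ 0}`, where
`Ext_GP` is computed by a proper GP-resolution of `M`. The supremum is the same for all proper
GP-resolutions of `M` (see `gpDim_eq`), so the outer infimum only says "take a proper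
GP-resolution". As for other dimensions in Mathlib, the zero module has dimension `⊥ = sup ∅`;
a module without any proper GP-resolution would count as being of infinite dimension (over an
artin algebra there is no such module). -/
noncomputable def gpDim {A : Type u} [Ring A] (M : ModuleCat.{u} A) : WithBot ℕ∞ :=
  ⨅ G : ProperGPResolution M,
    ⨆ (n : ℕ) (_ : ∃ N : ModuleCat.{u} A, ¬ Limits.IsZero (G.ext n N)), (n : WithBot ℕ∞)

/-- The Gorenstein-projective dimension can be computed with any proper GP-resolution. -/
theorem gpDim_eq {A : Type u} [Ring A] {M : ModuleCat.{u} A} (G : ProperGPResolution M) :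
    gpDim M = ⨆ (n : ℕ) (_ : ∃ N : ModuleCat.{u} A, ¬ Limits.IsZero (G.ext n N)), (n : WithBot ℕ∞) := by
  have : Nonempty (ProperGPResolution M) := ⟨G⟩
  unfold gpDim
  have key : ∀ G' : ProperGPResolution M,
    (⨆ (n : ℕ) (_ : ∃ N : ModuleCat.{u} A, ¬ Limits.IsZero (G'.ext n N)), (n : WithBot ℕ∞)) = ⨆ (n : ℕ) (_ : ∃ N : ModuleCat.{u} A, ¬ Limits.IsZero (G.ext n N)), (n : WithBot ℕ∞) := fun G' ↦ by
    simp only [G'.isZero_ext_iff G]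
  simp only [key, ciInf_const]

/-- The global Gorenstein-projective dimension: the supremum of `GP.dim M` over all modules. -/
noncomputable def globalGPDim (A : Type u) [Ring A] : WithBot ℕ∞ :=
  ⨆ M : ModuleCat.{u} A, gpDim M

/-- `A` is Gorenstein if the regular module has finite injective dimension on both sides.
Right `A`-modules are left modules over `Aᵐᵒᵖ`. -/
def IsGorensteinAlgebra (A : Type u) [Ring A] : Prop :=
  injectiveDimension (ModuleCat.of A A) < ⊤ ∧ injectiveDimension (ModuleCat.of Aᵐᵒᵖ A) < ⊤

/-! Both dimensions are compared through their natural-number bounds, and the link between left and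
right modules is the character dual `D = Hom(-, ℚ/ℤ)`.

Suppose the global GP-dimension is at most `n`. Vanishing of `Ext_GP` above `n` splits a proper
resolution of `M` at its `n`-th syzygy, so `M` has a Gorenstein-projective resolution of length `n`.
Hence `Ext^i(M, Q) = 0` for `i > n` and `Q` projective, which bounds the injective dimension of the
left regular module by `n`. Moreover `M` embeds into a module of finite projective dimension
(`exists_shortExact_finiteProjectiveDimension`). Every injective left module is then a summand of
such a module, and its projective dimension is at most `n`. Applied to the dual of the right regular
module, this bounds the injective dimension of the double dual of that regular module. Purity in the
double dual brings the bound back to the regular module itself.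

Suppose conversely that the left and right injective dimensions are at most `n` and `m`. Sums of
injectives are injective over a noetherian ring, so all projective left modules have injective
dimension at most `n`. An injective left module `J` has a dual which is a summand of the double dual
of a free right module, so `DJ` has injective dimension at most `m`. Thus `J` has flat dimension at
most `m`, and projective dimension at most `m` because the ring is semiprimary. Consequently every
`M` has a precover `0 → Y → G → M → 0` with `Y` of finite projective dimension and `G`
Gorenstein-projective (`exists_special_precover`). Iterating gives a proper resolution that splits
from the `n`-th syzygy on, so the global GP-dimension is at most `n`, whatever `m` is. -/

/-! ### Vanishing of Ext along short exact sequences and retracts. -/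

section ExtLemmas

open Abelian

universe w v' u'

variable {C : Type u'} [Category.{v'} C] [Abelian C] [HasExt.{w} C]

namespace CategoryTheory.ShortComplex.ShortExact

variable {S : ShortComplex C} (hS : S.ShortExact)

include hS

theorem subsingleton_ext_X₃ (Y : C) (n : ℕ) (h₁ : Subsingleton (Ext S.X₁ Y n))
    (h₂ : Subsingleton (Ext S.X₂ Y (n + 1))) : Subsingleton (Ext S.X₃ Y (n + 1)) := by
  refine subsingleton_of_forall_eq 0 fun x ↦ ?_
  obtain ⟨y, rfl⟩ := Ext.contravariant_sequence_exact₃ hS Y x (Subsingleton.elim _ _) (add_comm 1 n)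
  rw [Subsingleton.elim y 0, Ext.comp_zero]

theorem subsingleton_ext_X₂ (Y : C) (n : ℕ) (h₁ : Subsingleton (Ext S.X₁ Y n))
    (h₃ : Subsingleton (Ext S.X₃ Y n)) : Subsingleton (Ext S.X₂ Y n) := by
  refine subsingleton_of_forall_eq 0 fun x ↦ ?_
  obtain ⟨y, rfl⟩ := Ext.contravariant_sequence_exact₂ hS Y x (Subsingleton.elim _ _)
  rw [Subsingleton.elim y 0, Ext.comp_zero]

theorem subsingleton_ext_X₁ (Y : C) (n : ℕ) (h₂ : Subsingleton (Ext S.X₂ Y n))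
    (h₃ : Subsingleton (Ext S.X₃ Y (n + 1))) : Subsingleton (Ext S.X₁ Y n) := by
  refine subsingleton_of_forall_eq 0 fun x ↦ ?_
  obtain ⟨y, rfl⟩ := Ext.contravariant_sequence_exact₁ hS Y x (add_comm 1 n) (Subsingleton.elim _ _)
  rw [Subsingleton.elim y 0, Ext.comp_zero]

theorem subsingleton_ext_of_X₁_X₃ (X : C) (n : ℕ) (h₁ : Subsingleton (Ext X S.X₁ n))
    (h₃ : Subsingleton (Ext X S.X₃ n)) : Subsingleton (Ext X S.X₂ n) := by
  refine subsingleton_of_forall_eq 0 fun x ↦ ?_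
  obtain ⟨y, rfl⟩ := Ext.covariant_sequence_exact₂ X hS x (Subsingleton.elim _ _)
  rw [Subsingleton.elim y 0, Ext.zero_comp]

theorem subsingleton_ext_of_X₁_X₂ (X : C) (n : ℕ) (h₁ : Subsingleton (Ext X S.X₁ (n + 1)))
    (h₂ : Subsingleton (Ext X S.X₂ n)) : Subsingleton (Ext X S.X₃ n) := by
  refine subsingleton_of_forall_eq 0 fun x ↦ ?_
  obtain ⟨y, rfl⟩ := Ext.covariant_sequence_exact₃ X hS x rfl (Subsingleton.elim _ _)
  rw [Subsingleton.elim y 0, Ext.zero_comp]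

theorem exists_extension (Y : C) (h : Subsingleton (Ext S.X₃ Y 1)) (f : S.X₁ ⟶ Y) :
    ∃ g : S.X₂ ⟶ Y, S.f ≫ g = f := by
  obtain ⟨y, hy⟩ := Ext.contravariant_sequence_exact₁ hS Y (Ext.mk₀ f) (add_zero 1)
    (Subsingleton.elim _ _)
  obtain ⟨g, rfl⟩ := Ext.homEquiv₀.symm.surjective y
  exact ⟨g, Ext.homEquiv₀.symm.injective (by simpa using hy)⟩

theorem exists_lift (X : C) (h : Subsingleton (Ext X S.X₁ 1)) (f : X ⟶ S.X₃) :
    ∃ g : X ⟶ S.X₂, g ≫ S.g = f := by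
  obtain ⟨y, hy⟩ := Ext.covariant_sequence_exact₃ X hS (Ext.mk₀ f) (zero_add 1)
    (Subsingleton.elim _ _)
  obtain ⟨g, rfl⟩ := Ext.homEquiv₀.symm.surjective y
  exact ⟨g, Ext.homEquiv₀.symm.injective (by simpa using hy)⟩

theorem subsingleton_ext_one (Y : C) (h₂ : Subsingleton (Ext S.X₂ Y 1))
    (h : ∀ f : S.X₁ ⟶ Y, ∃ g : S.X₂ ⟶ Y, S.f ≫ g = f) : Subsingleton (Ext S.X₃ Y 1) := by
  refine subsingleton_of_forall_eq 0 fun x ↦ ?_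
  obtain ⟨y, rfl⟩ := Ext.contravariant_sequence_exact₃ hS Y x (Subsingleton.elim _ _) (add_zero 1)
  obtain ⟨f, rfl⟩ := Ext.homEquiv₀.symm.surjective y
  obtain ⟨g, rfl⟩ := h f
  have := hS.extClass_comp_assoc (Ext.mk₀ g) (h := add_zero 1)
  simpa using this

end CategoryTheory.ShortComplex.ShortExact

theorem CategoryTheory.Retract.subsingleton_ext {X X' : C} (r : Retract X X') (Y : C) (n : ℕ)
    (h : Subsingleton (Ext X' Y n)) : Subsingleton (Ext X Y n) := by
  refine subsingleton_of_forall_eq 0 fun x ↦ ?_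
  have : (Ext.mk₀ r.i).comp ((Ext.mk₀ r.r).comp x (zero_add n)) (zero_add n) = x := by
    rw [Ext.mk₀_comp_mk₀_assoc, r.retract, Ext.mk₀_id_comp]
  rw [← this, Subsingleton.elim ((Ext.mk₀ r.r).comp x (zero_add n)) 0, Ext.comp_zero]

theorem CategoryTheory.Retract.subsingleton_ext_right {Y Y' : C} (r : Retract Y Y') (X : C) (n : ℕ)
    (h : Subsingleton (Ext X Y' n)) : Subsingleton (Ext X Y n) := by
  refine subsingleton_of_forall_eq 0 fun x ↦ ?_
  have : (x.comp (Ext.mk₀ r.i) (add_zero n)).comp (Ext.mk₀ r.r) (add_zero n) = x := by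
    simp
  rw [← this, Subsingleton.elim (x.comp (Ext.mk₀ r.i) (add_zero n)) 0, Ext.zero_comp]

end ExtLemmas

/-! ### Projective and injective presentations as short exact sequences. -/

section EnoughLemmas

variable {C : Type*} [Category* C] [Abelian C]

theorem CategoryTheory.exists_shortExact_projective [EnoughProjectives C] (M : C) :
    ∃ (K P : C) (i : K ⟶ P) (p : P ⟶ M) (w : i ≫ p = 0),
      Projective P ∧ (ShortComplex.mk i p w).ShortExact := by
  let ⟨p⟩ := EnoughProjectives.presentation M
  exact ⟨_, _, _, p.f, Limits.kernel.condition p.f, p.projective,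
    { exact := ShortComplex.exact_kernel p.f }⟩

theorem CategoryTheory.exists_shortExact_injective [EnoughInjectives C] (M : C) :
    ∃ (I K : C) (i : M ⟶ I) (p : I ⟶ K) (w : i ≫ p = 0),
      Injective I ∧ (ShortComplex.mk i p w).ShortExact := by
  let ⟨p⟩ := EnoughInjectives.presentation M
  exact ⟨_, _, p.f, _, Limits.cokernel.condition p.f, p.injective,
    { exact := ShortComplex.exact_cokernel p.f }⟩

end EnoughLemmas

/-! ### Character modules and their self-adjunction. -/

section CharacterDual

variable {A B : Type u} [Ring A] [Ring B]

/-- The character module of a left `A`-module, as a left module over `B ≅ Aᵐᵒᵖ`. -/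
def CharDual (_τ : B ≃+* Aᵐᵒᵖ) (M : Type u) [AddCommGroup M] : Type u := M →+ AddCircle (1 : ℚ)

namespace CharDual

variable (τ : B ≃+* Aᵐᵒᵖ) {M N L : Type u} [AddCommGroup M] [AddCommGroup N] [AddCommGroup L]

instance : AddCommGroup (CharDual τ M) := inferInstanceAs (AddCommGroup (M →+ AddCircle (1 : ℚ)))

instance : FunLike (CharDual τ M) M (AddCircle (1 : ℚ)) :=
  inferInstanceAs (FunLike (M →+ AddCircle (1 : ℚ)) M (AddCircle (1 : ℚ)))

instance : AddMonoidHomClass (CharDual τ M) M (AddCircle (1 : ℚ)) :=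
  inferInstanceAs (AddMonoidHomClass (M →+ AddCircle (1 : ℚ)) M (AddCircle (1 : ℚ)))

variable {τ}

@[ext] theorem ext {f g : CharDual τ M} (h : ∀ x, f x = g x) : f = g := DFunLike.ext _ _ h

@[simp] theorem add_apply (f g : CharDual τ M) (x : M) : (f + g) x = f x + g x := rfl

@[simp] theorem zero_apply (x : M) : (0 : CharDual τ M) x = 0 := rfl

theorem sum_apply {ι : Type*} (s : Finset ι) (f : ι → CharDual τ M) (x : M) :
    (∑ i ∈ s, f i) x = ∑ i ∈ s, f i x :=
  AddMonoidHom.finsetSum_apply f s x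

variable (τ) in
/-- A homomorphism to the circle, as an element of the character module. -/
def of (f : M →+ AddCircle (1 : ℚ)) : CharDual τ M := f

@[simp] theorem of_apply (f : M →+ AddCircle (1 : ℚ)) (x : M) : of τ f x = f x := rfl

variable (τ) in
/-- Precomposition of characters with an additive map. -/
def precomp (f : M →+ N) : CharDual τ N →+ CharDual τ M :=
  AddMonoidHom.mk' (fun χ ↦ of τ ((χ : N →+ AddCircle (1 : ℚ)).comp f)) fun _ _ ↦ rfl

@[simp] theorem precomp_apply (f : M →+ N) (χ : CharDual τ N) (x : M) :
    precomp τ f χ x = χ (f x) := rfl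

theorem exists_extension {f : M →+ N} (hf : Function.Injective f) (χ : CharDual τ M) :
    ∃ ψ : CharDual τ N, ∀ x, ψ (f x) = χ x := by
  obtain ⟨ψ, hψ⟩ := CharacterModule.dual_surjective_of_injective f.toIntLinearMap hf χ
  exact ⟨ψ, fun x ↦ DFunLike.congr_fun hψ x⟩

theorem exists_apply_ne_zero {x : M} (hx : x ≠ 0) : ∃ χ : CharDual τ M, χ x ≠ 0 :=
  CharacterModule.exists_character_apply_ne_zero_of_ne_zero hx

/-- The character descends to `N ⧸ g.ker`, which embeds into `L`, and characters extend along
injections. -/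
theorem exists_factorization {f : M →+ N} {g : N →+ L} (hfg : ∀ y, g y = 0 → ∃ x, f x = y)
    (χ : CharDual τ N) (hχ : ∀ x, χ (f x) = 0) : ∃ ψ : CharDual τ L, ∀ y, ψ (g y) = χ y := by
  let χ' : CharDual τ (N ⧸ g.ker) := of τ (QuotientAddGroup.lift g.ker (χ : N →+ AddCircle (1 : ℚ))
    fun y hy ↦ by
      obtain ⟨x, rfl⟩ := hfg y hy
      exact hχ x)
  obtain ⟨ψ, hψ⟩ := exists_extension (QuotientAddGroup.kerLift_injective g) χ'
  exact ⟨ψ, fun y ↦ hψ (QuotientAddGroup.mk y)⟩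

variable [Module A M] [Module A N] [Module A L]

instance : Module B (CharDual τ M) where
  smul b f := of τ ((f : M →+ AddCircle (1 : ℚ)).comp
    (DistribSMul.toAddMonoidHom M (τ b).unop))
  one_smul f := by ext x; change f ((τ 1).unop • x) = _; simp
  mul_smul b c f := by
    ext x
    change f ((τ (b * c)).unop • x) = f ((τ c).unop • (τ b).unop • x)
    simp [mul_smul]
  smul_zero b := rfl
  zero_smul f := by ext x; change f ((τ 0).unop • x) = _; simp
  smul_add b f g := rfl
  add_smul b c f := by
    ext x
    change f ((τ (b + c)).unop • x) = f ((τ b).unop • x) + f ((τ c).unop • x)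
    simp [add_smul]

@[simp] theorem smul_apply (b : B) (f : CharDual τ M) (x : M) :
    (b • f) x = f ((τ b).unop • x) := rfl

variable (τ) in
/-- Functoriality of the character module. -/
def map (f : M →ₗ[A] N) : CharDual τ N →ₗ[B] CharDual τ M where
  toFun χ := of τ ((χ : N →+ AddCircle (1 : ℚ)).comp f.toAddMonoidHom)
  map_add' _ _ := rfl
  map_smul' b χ := by
    ext x
    exact congrArg χ (f.map_smul (τ b).unop x).symm

@[simp] theorem map_apply (f : M →ₗ[A] N) (χ : CharDual τ N) (x : M) : map τ f χ x = χ (f x) := rfl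

theorem map_surjective {f : M →ₗ[A] N} (hf : Function.Injective f) :
    Function.Surjective (map τ f) := fun χ ↦ by
  obtain ⟨ψ, hψ⟩ := exists_extension (f := f.toAddMonoidHom) hf χ
  exact ⟨ψ, ext hψ⟩

theorem map_injective {f : M →ₗ[A] N} (hf : Function.Surjective f) :
    Function.Injective (map τ f) := fun χ ψ h ↦ ext fun y ↦ by
  obtain ⟨x, rfl⟩ := hf y
  exact DFunLike.congr_fun h x

theorem map_exact {f : M →ₗ[A] N} {g : N →ₗ[A] L} (h : Function.Exact f g) :
    Function.Exact (map τ g) (map τ f) := fun χ ↦ by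
  refine ⟨fun hχ ↦ ?_, ?_⟩
  · obtain ⟨ψ, hψ⟩ := exists_factorization (f := f.toAddMonoidHom) (g := g.toAddMonoidHom)
      (fun y hy ↦ (h y).1 hy) χ (DFunLike.congr_fun hχ)
    exact ⟨ψ, ext hψ⟩
  · rintro ⟨ψ, rfl⟩
    ext x
    simp [h.apply_apply_eq_zero]

variable {τ' : A ≃+* Bᵐᵒᵖ}

/-- The adjunction between the two character module functors, on one hom-set. -/
def transpose (h : ∀ a, (τ (τ' a).unop).unop = a) {X : Type u} [AddCommGroup X] [Module B X]
    (f : X →ₗ[B] CharDual τ M) : M →ₗ[A] CharDual τ' X where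
  toFun x := of τ' ⟨⟨fun y ↦ f y x, by simp⟩, by simp⟩
  map_add' x y := by ext z; exact map_add (f z) x y
  map_smul' a x := by
    ext z
    change f z (a • x) = f ((τ' a).unop • z) x
    simp [h]

@[simp] theorem transpose_apply (h : ∀ a, (τ (τ' a).unop).unop = a) {X : Type u} [AddCommGroup X]
    [Module B X] (f : X →ₗ[B] CharDual τ M) (x : M) (y : X) : transpose h f x y = f y x := rfl

/-- The canonical map to the double dual. -/
def eval (h : ∀ a, (τ (τ' a).unop).unop = a) : M →ₗ[A] CharDual τ' (CharDual τ M) :=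
  transpose h LinearMap.id

@[simp] theorem eval_apply (h : ∀ a, (τ (τ' a).unop).unop = a) (x : M) (χ : CharDual τ M) :
    eval h x χ = χ x := rfl

theorem eval_injective (h : ∀ a, (τ (τ' a).unop).unop = a) :
    Function.Injective (eval (M := M) h) := by
  rw [injective_iff_map_eq_zero]
  intro x hx
  by_contra hx'
  obtain ⟨χ, hχ⟩ := exists_apply_ne_zero (τ := τ) hx'
  exact hχ (DFunLike.congr_fun hx χ)

/-- A map `X → DM` is the same as a map `M → DX`, and extending the former along `X ↪ Y` means
lifting the latter along the surjection `DY → DX`. The hypotheses `h` and `h'` make the two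
anti-isomorphisms mutually inverse, so that both sides play symmetric roles and a double dual is
again a module over the original ring. -/
theorem injective_of_projective (h : ∀ a, (τ (τ' a).unop).unop = a)
    (h' : ∀ b, (τ' (τ b).unop).unop = b) [Module.Projective A M] :
    Module.Injective B (CharDual τ M) where
  out X Y _ _ _ _ i hi f := by
    obtain ⟨g, hg⟩ := Module.projective_lifting_property (map τ' i) (transpose h f)
      (map_surjective hi)
    refine ⟨transpose h' g, fun x ↦ ?_⟩
    ext m
    exact DFunLike.congr_fun (DFunLike.congr_fun hg m) x

end CharDual

end CharacterDual

/-! ### Double duals: injectivity over noetherian rings, and purity. -/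

section DoubleDual

variable {A B : Type u} [Ring A] [Ring B] {τ : B ≃+* Aᵐᵒᵖ} {τ' : A ≃+* Bᵐᵒᵖ}

namespace CharDual

/-- Over a noetherian ring, a family in an injective module which satisfies all relations between
the generators of an ideal is obtained by multiplying a single element with the generators. -/
theorem _root_.Module.Injective.exists_smul_eq {J : Type u} [AddCommGroup J] [Module B J]
    [Module.Injective B J] {I : Ideal B} {r : ℕ} (k : Fin r → I)
    (hk : Submodule.span B (Set.range k) = ⊤) (y : Fin r → J)
    (hy : ∀ c : Fin r → B, ∑ j, c j • k j = 0 → ∑ j, c j • y j = 0) :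
    ∃ z : J, ∀ j, (k j : B) • z = y j := by
  classical
  let π := Fintype.linearCombination B k
  let θ := Fintype.linearCombination B y
  have hπ : Function.Surjective π := by
    rw [← LinearMap.range_eq_top, Fintype.range_linearCombination, hk]
  let θ' : I →ₗ[B] J := (π.ker.liftQ θ fun c hc ↦ hy c hc) ∘ₗ
    (π.quotKerEquivOfSurjective hπ).symm.toLinearMap
  obtain ⟨g, hg⟩ := Module.Injective.extension_property B J I B I.subtype I.injective_subtype θ'
  refine ⟨g 1, fun j ↦ ?_⟩
  have h1 : π (Pi.single j 1) = k j := by simp [π]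
  have h2 : θ' (π (Pi.single j 1)) = θ (Pi.single j 1) := by
    have : (π.quotKerEquivOfSurjective hπ).symm (π (Pi.single j 1)) =
        Submodule.Quotient.mk (Pi.single j 1) := by
      rw [LinearEquiv.symm_apply_eq]; rfl
    simp only [θ', LinearMap.comp_apply, LinearEquiv.coe_coe, this]
    exact Submodule.liftQ_apply _ _ _
  rw [← map_smul, smul_eq_mul, mul_one]
  refine (DFunLike.congr_fun hg (k j)).trans ?_
  rw [← h1, h2]
  simp [θ]

/-- The double dual preserves exactness. Additive maps are used because a matrix over a
noncommutative ring does not act linearly on powers of a module. -/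
theorem exists_charDual_apply_precomp {P Q S : Type u} [AddCommGroup P] [AddCommGroup Q]
    [AddCommGroup S] {T : P →+ Q} {U : Q →+ S} (hTU : ∀ y, U y = 0 → ∃ z, T z = y)
    (φ : CharDual τ (CharDual τ' Q)) (hφ : ∀ ψ : CharDual τ' S, φ (precomp τ' U ψ) = 0) :
    ∃ x : CharDual τ (CharDual τ' P), ∀ χ, x (precomp τ' T χ) = φ χ :=
  exists_factorization (f := precomp τ' U) (g := precomp τ' T) (fun χ hχ ↦ by
    obtain ⟨ψ, hψ⟩ := exists_factorization hTU χ fun x ↦ DFunLike.congr_fun hχ x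
    exact ⟨ψ, ext hψ⟩) φ hφ

variable (τ τ') in
/-- The isomorphism of the double dual of a finite power with the power of the double dual. -/
def piDoubleDual {M : Type u} [AddCommGroup M] {r : ℕ} (φ : Fin r → CharDual τ (CharDual τ' M)) :
    CharDual τ (CharDual τ' (Fin r → M)) :=
  ∑ j, precomp τ (precomp τ' (AddMonoidHom.single (fun _ ↦ M) j)) (φ j)

theorem piDoubleDual_apply {M : Type u} [AddCommGroup M] {r : ℕ}
    (φ : Fin r → CharDual τ (CharDual τ' M)) (χ : CharDual τ' (Fin r → M)) :
    piDoubleDual τ τ' φ χ = ∑ j, φ j (precomp τ' (AddMonoidHom.single (fun _ ↦ M) j) χ) :=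
  sum_apply _ _ _

theorem piDoubleDual_apply_eval {M : Type u} [AddCommGroup M] {r : ℕ}
    (φ : Fin r → CharDual τ (CharDual τ' M)) (χ : CharDual τ' M) (j : Fin r) :
    piDoubleDual τ τ' φ (precomp τ' (Pi.evalAddMonoidHom (fun _ ↦ M) j) χ) = φ j χ := by
  classical
  rw [piDoubleDual_apply, Finset.sum_eq_single j]
  · congr 1
    ext y
    simp
  · intro i _ hij
    rw [← map_zero (φ i)]
    congr 1
    ext y
    simp [Pi.single_eq_of_ne hij.symm]
  · simp

/-- The additive map `(y_j) ↦ (∑ j, R_lj y_j)` given by a matrix. -/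
def matrixHom {M : Type u} [AddCommGroup M] [Module B M] {r s : ℕ} (R : Fin s → Fin r → B) :
    (Fin r → M) →+ (Fin s → M) :=
  AddMonoidHom.mk' (fun y l ↦ ∑ j, R l j • y j) fun y z ↦ by
    ext l; simp [Finset.sum_add_distrib]

@[simp] theorem matrixHom_apply {M : Type u} [AddCommGroup M] [Module B M] {r s : ℕ}
    (R : Fin s → Fin r → B) (y : Fin r → M) (l : Fin s) :
    matrixHom R y l = ∑ j, R l j • y j := rfl

theorem precomp_single_precomp_matrixHom (h' : ∀ b, (τ' (τ b).unop).unop = b) {M : Type u}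
    [AddCommGroup M] [Module B M] {r s : ℕ} (R : Fin s → Fin r → B) (ψ : CharDual τ' (Fin s → M))
    (j : Fin r) :
    precomp τ' (AddMonoidHom.single (fun _ ↦ M) j) (precomp τ' (matrixHom R) ψ) =
      ∑ l, (τ (R l j)).unop • precomp τ' (AddMonoidHom.single (fun _ ↦ M) l) ψ := by
  classical
  ext y
  rw [sum_apply]
  simp only [smul_apply, h', precomp_apply, AddMonoidHom.single_apply]
  rw [← map_sum, Finset.univ_sum_single fun l ↦ R l j • y]
  congr 1
  ext l
  simp [Pi.single_apply]

/-- The double dual of a matrix map is given by the same matrix on powers of the double dual, so a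
tuple satisfying the relations `R` is killed by it. -/
theorem piDoubleDual_precomp_matrixHom (h' : ∀ b, (τ' (τ b).unop).unop = b) {M : Type u}
    [AddCommGroup M] [Module B M] {r s : ℕ} (R : Fin s → Fin r → B)
    (φ : Fin r → CharDual τ (CharDual τ' M)) (hφ : ∀ l, ∑ j, R l j • φ j = 0)
    (ψ : CharDual τ' (Fin s → M)) : piDoubleDual τ τ' φ (precomp τ' (matrixHom R) ψ) = 0 := by
  rw [piDoubleDual_apply]
  simp only [precomp_single_precomp_matrixHom h', map_sum]
  rw [Finset.sum_comm]
  refine Finset.sum_eq_zero fun l _ ↦ ?_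
  have := DFunLike.congr_fun (hφ l) (precomp τ' (AddMonoidHom.single (fun _ ↦ M) l) ψ)
  rw [sum_apply] at this
  exact this

/-- Baer's criterion. A finite presentation `B^s → B^r → I` of an ideal and injectivity of `J` make
`J → J^r → J^s` exact. Applying `D` twice keeps it exact and commutes with finite powers, so a map
from `I` to `DDJ`, being a tuple that satisfies the relations, comes from one element of `DDJ`. -/
theorem injective_charDual_charDual [IsNoetherianRing B] (h' : ∀ b, (τ' (τ b).unop).unop = b)
    {J : Type u} [AddCommGroup J] [Module B J] [Module.Injective B J] :
    Module.Injective B (CharDual τ (CharDual τ' J)) := by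
  refine Module.Baer.injective fun I Φ ↦ ?_
  obtain ⟨r, k, hk⟩ := Module.Finite.exists_fin (R := B) (M := I)
  obtain ⟨s, R, hR⟩ := Module.Finite.exists_fin (R := B) (M := (Fintype.linearCombination B k).ker)
  let T : J →+ (Fin r → J) := AddMonoidHom.mk' (fun y j ↦ (k j : B) • y) fun y z ↦ by
    ext j; simp
  have hTU (y : Fin r → J) (hy : matrixHom (fun l ↦ (R l : Fin r → B)) y = 0) : ∃ z, T z = y := by
    obtain ⟨z, hz⟩ := Module.Injective.exists_smul_eq k hk y fun c hc ↦ by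
      let θ := (Fintype.linearCombination B y) ∘ₗ (Fintype.linearCombination B k).ker.subtype
      have : θ = 0 := LinearMap.ext_on_range hR fun l ↦ congrFun hy l
      exact DFunLike.congr_fun this ⟨c, hc⟩
    exact ⟨z, funext hz⟩
  have hΦ (l : Fin s) : ∑ j, (R l : Fin r → B) j • Φ (k j) = 0 := by
    have : ∑ j, (R l : Fin r → B) j • k j = 0 := (R l).2
    rw [← map_zero Φ, ← this, map_sum]
    exact Finset.sum_congr rfl fun j _ ↦ (map_smul Φ _ _).symm
  have hφ := piDoubleDual_precomp_matrixHom h' (fun l ↦ (R l : Fin r → B)) (fun j ↦ Φ (k j)) hΦ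
  obtain ⟨x, hx⟩ := exists_charDual_apply_precomp hTU (piDoubleDual τ τ' fun j ↦ Φ (k j)) hφ
  let g : B →ₗ[B] CharDual τ (CharDual τ' J) := LinearMap.toSpanSingleton B _ x
  suffices h : g ∘ₗ I.subtype = Φ from ⟨g, fun b hb ↦ LinearMap.congr_fun h ⟨b, hb⟩⟩
  refine LinearMap.ext_on_range hk fun j ↦ ext fun χ ↦ ?_
  have h2 : precomp τ' T (precomp τ' (Pi.evalAddMonoidHom (fun _ ↦ J) j) χ) =
      (τ (k j)).unop • χ := by
    ext y
    simp only [smul_apply, h']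
    rfl
  rw [← piDoubleDual_apply_eval (fun j ↦ Φ (k j)) χ j, ← hx, h2]
  exact smul_apply (k j : B) x χ

/-- A module is pure in its double dual: extension problems along maps of finitely generated
modules into a finite free module can be solved if they can be solved in the double dual. -/
theorem exists_extension_of_eval (h : ∀ a, (τ (τ' a).unop).unop = a)
    {M : Type u} [AddCommGroup M] [Module A M] {K : Type u}
    [AddCommGroup K] [Module A K] [Module.Finite A K] {q : ℕ} (i : K →ₗ[A] (Fin q → A))
    (f : K →ₗ[A] M) (g : (Fin q → A) →ₗ[A] CharDual τ' (CharDual τ M))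
    (hg : g ∘ₗ i = eval h ∘ₗ f) : ∃ g' : (Fin q → A) →ₗ[A] M, g' ∘ₗ i = f := by
  classical
  obtain ⟨r, k, hk⟩ := Module.Finite.exists_fin (R := A) (M := K)
  let T : (Fin q → M) →+ (Fin r → M) := AddMonoidHom.mk' (fun y j ↦ ∑ l, i (k j) l • y l)
    fun y z ↦ by ext j; simp [Finset.sum_add_distrib]
  suffices ∃ y, T y = fun j ↦ f (k j) by
    obtain ⟨y, hy⟩ := this
    refine ⟨Fintype.linearCombination A y, LinearMap.ext_on_range hk fun j ↦ ?_⟩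
    simpa [Fintype.linearCombination_apply, T] using congrFun hy j
  by_contra hcon
  -- If the finite linear system has no solution, some character kills the range of `T` but not the
  -- right-hand side; the solution in the double dual rules this out.
  have : (QuotientAddGroup.mk (fun j ↦ f (k j)) : (Fin r → M) ⧸ T.range) ≠ 0 := by
    rw [Ne, QuotientAddGroup.eq_zero_iff]
    exact hcon
  obtain ⟨χ', hχ'⟩ := exists_apply_ne_zero (τ := τ) this
  let χ : CharDual τ (Fin r → M) := of τ ((χ' : (Fin r → M) ⧸ T.range →+ _).comp (QuotientAddGroup.mk' T.range))
  have hχ (y) : χ (T y) = 0 := by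
    change χ' (QuotientAddGroup.mk (T y)) = 0
    rw [(QuotientAddGroup.eq_zero_iff (T y)).2 (AddMonoidHom.mem_range.2 ⟨y, rfl⟩), map_zero]
  let χj (j : Fin r) : CharDual τ M := of τ ((χ : (Fin r → M) →+ _).comp (AddMonoidHom.single (fun _ ↦ M) j))
  apply hχ'
  change χ (fun j ↦ f (k j)) = 0
  have e1 : χ (fun j ↦ f (k j)) = ∑ j, g (i (k j)) (χj j) := by
    rw [← Finset.univ_sum_single fun j ↦ f (k j), map_sum]
    refine Finset.sum_congr rfl fun j _ ↦ ?_
    exact (DFunLike.congr_fun (DFunLike.congr_fun hg (k j)) (χj j)).symm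
  have e2 (j : Fin r) : g (i (k j)) = ∑ l, i (k j) l • g (Pi.single l 1) := by
    conv_lhs => rw [← Finset.univ_sum_single (i (k j))]
    rw [map_sum]
    refine Finset.sum_congr rfl fun l _ ↦ ?_
    rw [← map_smul, ← Pi.single_smul, smul_eq_mul, mul_one]
  -- This is `χ ∘ T = 0` restricted to the `l`-th summand, read as a relation between the characters
  -- `χj`.
  have e3 (l : Fin q) : ∑ j, (τ' (i (k j) l)).unop • χj j = 0 := by
    ext y
    rw [sum_apply]
    simp only [smul_apply, h]
    change ∑ j, χ (Pi.single j (i (k j) l • y)) = 0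
    rw [← map_sum, Finset.univ_sum_single fun j ↦ i (k j) l • y, ← hχ (Pi.single l y)]
    congr 1
    ext j
    simp [T, Pi.single_apply]
  rw [e1]
  simp only [e2, sum_apply, smul_apply]
  rw [Finset.sum_comm]
  refine Finset.sum_eq_zero fun l _ ↦ ?_
  rw [← map_sum, e3, map_zero]

end CharDual

end DoubleDual

/-! ### Homological dimensions under duality, and direct sums of injectives. -/

section DualDimension

open Abelian

variable {A B : Type u} [Ring A] [Ring B] {τ : B ≃+* Aᵐᵒᵖ} {τ' : A ≃+* Bᵐᵒᵖ}

namespace CharDual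

variable (τ) in
/-- The character module as an object of the category of modules. -/
abbrev obj (M : ModuleCat.{u} A) : ModuleCat.{u} B := ModuleCat.of B (CharDual τ M)

theorem shortExact_map {S : ShortComplex (ModuleCat.{u} A)} (hS : S.ShortExact) :
    (ShortComplex.mk (X₁ := obj τ S.X₃) (X₂ := obj τ S.X₂) (X₃ := obj τ S.X₁)
      (ModuleCat.ofHom (map τ S.g.hom)) (ModuleCat.ofHom (map τ S.f.hom)) (by
        ext χ
        refine CharDual.ext (τ := τ) fun x ↦ ?_
        change χ (S.g (S.f x)) = 0
        rw [S.moduleCat_zero_apply, map_zero])).ShortExact := by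
  refine ModuleCat.shortComplex_shortExact _ ?_ ?_ ?_
  · exact map_exact ((ShortComplex.ShortExact.moduleCat_exact_iff_function_exact _).1 hS.exact)
  · exact map_injective hS.moduleCat_surjective_g
  · exact map_surjective hS.moduleCat_injective_f

theorem hasInjectiveDimensionLT_obj (h : ∀ a, (τ (τ' a).unop).unop = a)
    (h' : ∀ b, (τ' (τ b).unop).unop = b) (n : ℕ) (M : ModuleCat.{u} A)
    (hM : HasProjectiveDimensionLT M (n + 1)) : HasInjectiveDimensionLT (obj τ M) (n + 1) := by
  induction n generalizing M with
  | zero =>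
    have : Projective M := projective_iff_hasProjectiveDimensionLT_one.2 hM
    have : Injective (obj τ M) := by
      rw [← Module.injective_iff_injective_object]
      exact injective_of_projective h h'
    infer_instance
  | succ n ih =>
    obtain ⟨K, P, i, p, w, hP, hS⟩ := exists_shortExact_projective M
    have hK := ih K ((hS.hasProjectiveDimensionLT_X₃_iff n hP).1 hM)
    have : Injective (obj τ P) := by
      rw [← Module.injective_iff_injective_object]
      exact injective_of_projective h h'
    exact ((shortExact_map hS).hasInjectiveDimensionLT_X₃_iff n this).1 hK

theorem hasInjectiveDimensionLT_obj_obj [IsNoetherianRing B] (h' : ∀ b, (τ' (τ b).unop).unop = b)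
    (n : ℕ) (M : ModuleCat.{u} B) (hM : HasInjectiveDimensionLT M (n + 1)) :
    HasInjectiveDimensionLT (obj τ (obj τ' M)) (n + 1) := by
  have key (J : ModuleCat.{u} B) (hJ : Injective J) : Injective (obj τ (obj τ' J)) := by
    have : Module.Injective B J := Module.injective_module_of_injective_object B J
    rw [← Module.injective_iff_injective_object]
    exact injective_charDual_charDual h'
  induction n generalizing M with
  | zero =>
    have := key M (injective_iff_hasInjectiveDimensionLT_one.2 hM)
    infer_instance
  | succ n ih =>
    obtain ⟨I, K, i, p, w, hI, hS⟩ := exists_shortExact_injective M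
    have hK := ih K ((hS.hasInjectiveDimensionLT_X₃_iff n hI).2 hM)
    exact ((shortExact_map (shortExact_map hS)).hasInjectiveDimensionLT_X₃_iff n (key I hI)).1 hK

end CharDual

theorem exists_shortExact_finite [IsNoetherianRing A] (N : ModuleCat.{u} A) [Module.Finite A N] :
    ∃ (K : ModuleCat.{u} A) (q : ℕ) (i : K ⟶ ModuleCat.of A (Fin q → A))
      (p : ModuleCat.of A (Fin q → A) ⟶ N) (w : i ≫ p = 0), Module.Finite A K ∧
        (ShortComplex.mk i p w).ShortExact := by
  obtain ⟨q, f, hf⟩ := Module.Finite.exists_fin' A N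
  exact ⟨_, q, _, _, _, inferInstanceAs (Module.Finite A f.ker), LinearMap.shortExact_shortComplexKer hf⟩

/-- Baer's criterion only tests the cyclic modules `A ⧸ I`; higher dimensions reduce to this by
passing to cosyzygies of `M`. -/
theorem hasInjectiveDimensionLT_of_finite (n : ℕ) (M : ModuleCat.{u} A)
    (h : ∀ N : ModuleCat.{u} A, Module.Finite A N → Subsingleton (Ext N M (n + 1))) :
    HasInjectiveDimensionLT M (n + 1) := by
  induction n generalizing M with
  | zero =>
    suffices Injective M from inferInstance
    refine (Module.injective_iff_injective_object A M).1 (Module.Baer.injective fun I f ↦ ?_)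
    have hS := ModuleCat.shortComplex_shortExact (ModuleCat.shortComplexOfCompEqZero I.subtype I.mkQ
      (by ext x; simp)) (LinearMap.exact_subtype_mkQ I) I.injective_subtype I.mkQ_surjective
    obtain ⟨g, hg⟩ := hS.exists_extension M (h _ (inferInstanceAs (Module.Finite A (A ⧸ I))))
      (ModuleCat.ofHom f)
    exact ⟨g.hom, fun x hx ↦ congrArg (fun k ↦ k.hom ⟨x, hx⟩) hg⟩
  | succ n ih =>
    obtain ⟨I, K, i, p, w, hI, hS⟩ := exists_shortExact_injective M
    refine (hS.hasInjectiveDimensionLT_X₃_iff n hI).1 (ih K fun N hN ↦ ?_)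
    exact hS.subsingleton_ext_of_X₁_X₂ N (n + 1) (h N hN) (Ext.subsingleton_of_injective _ _ _)

namespace CharDual

/-- Purity settles degree one through a finite free cover of `N`. Syzygies of `N` stay finitely
generated over a noetherian ring, so the higher degrees follow by dimension shift. -/
theorem subsingleton_ext_of_obj_obj [IsNoetherianRing A] (h : ∀ a, (τ (τ' a).unop).unop = a)
    (M N : ModuleCat.{u} A) [Module.Finite A N] (n : ℕ)
    (hN : Subsingleton (Ext N (obj τ' (obj τ M)) (n + 1))) : Subsingleton (Ext N M (n + 1)) := by
  induction n generalizing N with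
  | zero =>
    obtain ⟨K, q, i, p, w, hK, hS⟩ := exists_shortExact_finite N
    have hF : Projective (ModuleCat.of A (Fin q → A)) := inferInstance
    refine hS.subsingleton_ext_one M (Ext.subsingleton_of_projective _ _ _) fun f ↦ ?_
    obtain ⟨g, hg⟩ := hS.exists_extension _ hN (f ≫ ModuleCat.ofHom (eval h))
    obtain ⟨g', hg'⟩ := exists_extension_of_eval h i.hom f.hom g.hom (congrArg ModuleCat.Hom.hom hg)
    exact ⟨ModuleCat.ofHom g', ModuleCat.hom_ext hg'⟩
  | succ n ih =>
    obtain ⟨K, q, i, p, w, hK, hS⟩ := exists_shortExact_finite N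
    have hF : Projective (ModuleCat.of A (Fin q → A)) := inferInstance
    refine hS.subsingleton_ext_X₃ M (n + 1) (ih K ?_) (Ext.subsingleton_of_projective _ _ _)
    exact hS.subsingleton_ext_X₁ _ (n + 1) (Ext.subsingleton_of_projective _ _ _) hN

theorem hasInjectiveDimensionLT_of_obj_obj [IsNoetherianRing A]
    (h : ∀ a, (τ (τ' a).unop).unop = a) (M : ModuleCat.{u} A) (n : ℕ)
    (hM : HasInjectiveDimensionLT (obj τ' (obj τ M)) (n + 1)) :
    HasInjectiveDimensionLT M (n + 1) :=
  hasInjectiveDimensionLT_of_finite n M fun N _ ↦ subsingleton_ext_of_obj_obj h M N n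
    (HasInjectiveDimensionLT.subsingleton _ (n + 1) _ le_rfl N)

/-- By adjunction, extending `K → DN` to `P` means lifting `N → DK` to `DP`, and the obstruction
lies in `Ext¹(N, DX) = 0`. -/
theorem subsingleton_ext_one_obj (h : ∀ a, (τ (τ' a).unop).unop = a)
    (h' : ∀ b, (τ' (τ b).unop).unop = b) (X : ModuleCat.{u} A) (hX : Injective (obj τ X))
    (N : ModuleCat.{u} B) : Subsingleton (Ext X (obj τ' N) 1) := by
  obtain ⟨K, P, i, p, w, hP, hS⟩ := exists_shortExact_projective X
  refine hS.subsingleton_ext_one _ (Ext.subsingleton_of_projective _ _ _) fun f ↦ ?_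
  obtain ⟨g, hg⟩ := (shortExact_map (τ := τ) hS).exists_lift N (Ext.subsingleton_of_injective _ _ _)
    (ModuleCat.ofHom (transpose h' f.hom))
  refine ⟨ModuleCat.ofHom (transpose h g.hom), ModuleCat.hom_ext (LinearMap.ext fun x ↦ ?_)⟩
  refine CharDual.ext (τ := τ') fun y ↦ ?_
  exact DFunLike.congr_fun (ConcreteCategory.congr_hom hg y) x

/-- Injectivity of `DX` expresses flatness of `X`, and flat modules over a semiprimary ring are
projective: `Ext¹(X, -)` vanishes on semisimple modules, hence on everything built from them by
extensions. -/
theorem projective_of_injective_obj [IsSemiprimaryRing A] (h : ∀ a, (τ (τ' a).unop).unop = a)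
    (h' : ∀ b, (τ' (τ b).unop).unop = b) (X : ModuleCat.{u} A) (hX : Injective (obj τ X)) :
    Projective X := by
  rw [projective_iff_subsingleton_ext_one]
  intro M
  refine IsSemiprimaryRing.induction ℤ A M
    (P := fun M _ _ _ ↦ Subsingleton (Ext X (ModuleCat.of A M) 1)) ?_ ?_
  · intro M _ _ _ _ _ hM
    -- The double dual is still killed by the radical, hence semisimple, so `M` is a direct summand
    -- of it.
    have hDD : Module.IsTorsionBySet A (CharDual τ' (CharDual τ M)) (Ring.jacobson A) := by
      intro ξ a
      ext χ
      have : (τ' (a : A)).unop • χ = 0 := by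
        ext x
        simp only [smul_apply, h]
        rw [show (a : A) • x = 0 from @hM x a, map_zero]
        rfl
      change ((a : A) • ξ) χ = 0
      rw [smul_apply, this, map_zero]
    have : IsSemisimpleModule A (CharDual τ' (CharDual τ M)) := by
      let _ := hDD.module
      exact (hDD.semilinearMap.isSemisimpleModule_iff_of_bijective Function.bijective_id).2
        inferInstance
    obtain ⟨r, hr⟩ := IsSemisimpleModule.extension_property (eval (M := M) h)
      (eval_injective h) LinearMap.id
    have R : Retract (ModuleCat.of A M) (obj τ' (obj τ (ModuleCat.of A M))) :=
      { i := ModuleCat.ofHom (eval h)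
        r := ModuleCat.ofHom r
        retract := by ext x; exact LinearMap.congr_fun hr x }
    exact R.subsingleton_ext_right X 1 (subsingleton_ext_one_obj h h' X hX _)
  · intro M _ _ _ _ N hN hMN
    have hS := ModuleCat.shortComplex_shortExact (ModuleCat.shortComplexOfCompEqZero N.subtype N.mkQ
      (by ext x; simp)) (LinearMap.exact_subtype_mkQ N) N.injective_subtype N.mkQ_surjective
    exact hS.subsingleton_ext_of_X₁_X₃ X 1 hN hMN

theorem hasProjectiveDimensionLT_of_obj [IsSemiprimaryRing A]
    (h : ∀ a, (τ (τ' a).unop).unop = a) (h' : ∀ b, (τ' (τ b).unop).unop = b) (n : ℕ)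
    (M : ModuleCat.{u} A) (hM : HasInjectiveDimensionLT (obj τ M) (n + 1)) :
    HasProjectiveDimensionLT M (n + 1) := by
  induction n generalizing M with
  | zero =>
    have := projective_of_injective_obj h h' M
      (injective_iff_hasInjectiveDimensionLT_one.2 hM)
    infer_instance
  | succ n ih =>
    obtain ⟨K, P, i, p, w, hP, hS⟩ := exists_shortExact_projective M
    have : Injective (obj τ P) := by
      rw [← Module.injective_iff_injective_object]
      exact injective_of_projective h h'
    exact (hS.hasProjectiveDimensionLT_X₃_iff n hP).2
      (ih K (((shortExact_map hS).hasInjectiveDimensionLT_X₃_iff n this).2 hM))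

end CharDual

/-- Extend coordinatewise. The images of finitely many generators of the ideal meet only finitely
many coordinates, and the extension may be set to zero in all others. -/
theorem Module.Injective.finsupp [IsNoetherianRing A] (ι J : Type u) [AddCommGroup J] [Module A J]
    [Module.Injective A J] : Module.Injective A (ι →₀ J) := by
  classical
  refine Module.Baer.injective fun I f ↦ ?_
  obtain ⟨r, k, hk⟩ := Module.Finite.exists_fin (R := A) (M := I)
  have h (x : ι) : ∃ y : J, ∀ b : I, (b : A) • y = f b x := by
    obtain ⟨g, hg⟩ := Module.Injective.extension_property A J I A I.subtype I.injective_subtype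
      (Finsupp.lapply x ∘ₗ f)
    refine ⟨g 1, fun b ↦ ?_⟩
    rw [← map_smul, smul_eq_mul, mul_one]
    exact DFunLike.congr_fun hg b
  choose y hy using h
  let s : Finset ι := Finset.univ.biUnion fun j ↦ (f (k j)).support
  let g : A →ₗ[A] (ι →₀ J) :=
    LinearMap.toSpanSingleton A (ι →₀ J) (Finsupp.onFinset s (fun x ↦ if x ∈ s then y x else 0)
      (by simp +contextual))
  suffices H : g ∘ₗ I.subtype = f from ⟨g, fun b hb ↦ LinearMap.congr_fun H ⟨b, hb⟩⟩
  refine LinearMap.ext_on_range hk fun j ↦ Finsupp.ext fun x ↦ ?_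
  by_cases hx : x ∈ s
  · simpa [g, hx] using hy x (k j)
  · have : f (k j) x = 0 := by
      by_contra H
      exact hx (Finset.mem_biUnion.2 ⟨j, Finset.mem_univ _, Finsupp.mem_support_iff.2 H⟩)
    simp [g, hx, this]

theorem hasInjectiveDimensionLT_finsupp [IsNoetherianRing A] (ι : Type u) (n : ℕ)
    (M : ModuleCat.{u} A) (hM : HasInjectiveDimensionLT M (n + 1)) :
    HasInjectiveDimensionLT (ModuleCat.of A (ι →₀ M)) (n + 1) := by
  have key (J : ModuleCat.{u} A) (hJ : Injective J) : Injective (ModuleCat.of A (ι →₀ J)) := by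
    have : Module.Injective A J := Module.injective_module_of_injective_object A J
    rw [← Module.injective_iff_injective_object]
    exact Module.Injective.finsupp ι J
  induction n generalizing M with
  | zero =>
    have := key M (injective_iff_hasInjectiveDimensionLT_one.2 hM)
    infer_instance
  | succ n ih =>
    obtain ⟨I, K, i, p, w, hI, hS⟩ := exists_shortExact_injective M
    have hK := ih K ((hS.hasInjectiveDimensionLT_X₃_iff n hI).2 hM)
    have hS' := ModuleCat.shortComplex_shortExact (ModuleCat.shortComplexOfCompEqZero
      (Finsupp.mapRange.linearMap (α := ι) i.hom) (Finsupp.mapRange.linearMap p.hom) (by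
        rw [← Finsupp.mapRange.linearMap_comp, ← ModuleCat.hom_comp, w]
        ext; simp)) ?_ ?_ ?_
    · exact (hS'.hasInjectiveDimensionLT_X₃_iff n (key I hI)).1 hK
    · have hex := (ShortComplex.ShortExact.moduleCat_exact_iff_function_exact _).1 hS.exact
      intro f
      refine ⟨fun hf ↦ ?_, ?_⟩
      · have (x : ι) : ∃ y, i.hom y = f x := (hex (f x)).1 (DFunLike.congr_fun hf x)
        choose y hy using this
        classical
        refine ⟨Finsupp.onFinset f.support (fun x ↦ if f x = 0 then 0 else y x) (by simp +contextual),
          Finsupp.ext fun x ↦ ?_⟩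
        by_cases hx : f x = 0
        · simp [hx]
        · simpa [hx] using hy x
      · rintro ⟨g, rfl⟩
        ext x
        exact hex.apply_apply_eq_zero (g x)
    · exact Finsupp.mapRange_injective _ (map_zero _) hS.moduleCat_injective_f
    · exact Finsupp.mapRange_surjective _ (map_zero _) hS.moduleCat_surjective_g

theorem hasInjectiveDimensionLT_of_projective [IsNoetherianRing A] (n : ℕ)
    (hA : HasInjectiveDimensionLT (ModuleCat.of A A) (n + 1)) (Q : ModuleCat.{u} A)
    (hQ : Projective Q) : HasInjectiveDimensionLT Q (n + 1) := by
  have : Module.Projective A Q := inferInstance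
  obtain ⟨s, hs⟩ := Module.projective_def.1 this
  have R : Retract Q (ModuleCat.of A (Q →₀ A)) :=
    ⟨ModuleCat.ofHom s, ModuleCat.ofHom (Finsupp.linearCombination A id),
      ModuleCat.hom_ext (LinearMap.ext hs)⟩
  have := hasInjectiveDimensionLT_finsupp Q n _ hA
  exact R.hasInjectiveDimensionLT (n + 1)

namespace CharDual

/-- If injective left modules have projective dimension at most `n`, the regular right module has
injective dimension at most `n`. -/
theorem hasInjectiveDimensionLT_of_injective [IsNoetherianRing B]
    (h : ∀ a, (τ (τ' a).unop).unop = a) (h' : ∀ b, (τ' (τ b).unop).unop = b) (n : ℕ)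
    (H : ∀ J : ModuleCat.{u} A, Injective J → HasProjectiveDimensionLT J (n + 1)) :
    HasInjectiveDimensionLT (ModuleCat.of B B) (n + 1) := by
  -- `H` is applied to the injective module `DB`; dualizing once more bounds `DDB`, and purity
  -- passes the bound to `B`.
  refine hasInjectiveDimensionLT_of_obj_obj (τ := τ') (τ' := τ) h' _ n
    (hasInjectiveDimensionLT_obj h h' n _ (H _ ?_))
  rw [← Module.injective_iff_injective_object]
  exact injective_of_projective h' h

/-- If the regular right module has injective dimension at most `n`, injective left modules have
projective dimension at most `n`. -/
theorem hasProjectiveDimensionLT_of_injective [IsNoetherianRing B] [IsSemiprimaryRing A]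
    (h : ∀ a, (τ (τ' a).unop).unop = a) (h' : ∀ b, (τ' (τ b).unop).unop = b) (n : ℕ)
    (hB : HasInjectiveDimensionLT (ModuleCat.of B B) (n + 1)) (J : ModuleCat.{u} A)
    (hJ : Injective J) : HasProjectiveDimensionLT J (n + 1) := by
  refine hasProjectiveDimensionLT_of_obj h h' n J ?_
  let F := ModuleCat.of B (CharDual τ J →₀ B)
  let π : F ⟶ obj τ J := ModuleCat.ofHom (Finsupp.linearCombination B id)
  let j : J ⟶ obj τ' F := ModuleCat.ofHom (map τ' π.hom ∘ₗ eval h)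
  -- With `F` free onto `DJ`, there are embeddings `J ↪ DDJ ↪ DF`. The composite splits by
  -- injectivity, so `DJ` is a retract of `DDF`.
  have hj : Mono j := (ModuleCat.mono_iff_injective _).2
    ((map_injective (Finsupp.linearCombination_id_surjective B _)).comp (eval_injective h))
  let r := Injective.factorThru (𝟙 J) j
  have hr : j ≫ r = 𝟙 J := Injective.comp_factorThru _ _
  have R : Retract (obj τ J) (obj τ (obj τ' F)) := by
    refine ⟨ModuleCat.ofHom (map τ r.hom), ModuleCat.ofHom (map τ j.hom), ?_⟩
    ext χ
    refine CharDual.ext (τ := τ) fun x ↦ ?_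
    change χ (r (j x)) = χ x
    rw [← ConcreteCategory.comp_apply, hr, ConcreteCategory.id_apply]
  have := hasInjectiveDimensionLT_obj_obj (τ := τ) (τ' := τ') h' n F
    (hasInjectiveDimensionLT_finsupp _ n _ hB)
  exact R.hasInjectiveDimensionLT (n + 1)

end CharDual

end DualDimension

/-! ### Totally acyclic complexes from spliced short exact sequences, and back. -/

section GorensteinProjective

open Abelian

variable {A : Type u} [Ring A]

/-- `Ext^i(M, Q) = 0` for all projective modules `Q` and all `i > k`. -/
def ExtProjVanishes (k : ℕ) (M : ModuleCat.{u} A) : Prop :=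
  ∀ Q : ModuleCat.{u} A, Projective Q → ∀ i, k < i → Subsingleton (Ext M Q i)

theorem exactAt_linearYonedaObj_iff (K : ChainComplex (ModuleCat.{u} A) ℤ) (Q : ModuleCat.{u} A)
    (n : ℤ) : (K.linearYonedaObj ℤ Q).ExactAt (n + 1) ↔
      ∀ f : K.X (n + 1) ⟶ Q, K.d (n + 1 + 1) (n + 1) ≫ f = 0 →
        ∃ g : K.X n ⟶ Q, K.d (n + 1) n ≫ g = f := by
  rw [HomologicalComplex.exactAt_iff' _ n (n + 1) (n + 1 + 1)
    (ComplexShape.prev_eq' _ (by simp)) (ComplexShape.next_eq' _ (by simp)),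
    ShortComplex.moduleCat_exact_iff]
  rfl

theorem ChainComplex.of_d_succ {α : Type*} [AddRightCancelSemigroup α] [One α] [DecidableEq α]
    {X : α → ModuleCat.{u} A} {d : ∀ n, X (n + 1) ⟶ X n}
    (sq : ∀ n, d (n + 1) ≫ d n = 0) (n : α) : (ChainComplex.of X d sq).d (n + 1) n = d n :=
  ChainComplex.of_d ..

/-- A cocycle `P (n + 1) → Q` factors through `W (n + 1)`, and it extends to `P n` because `Ext¹(W
n, Q) = 0`. -/
theorem isTotallyAcyclic_of_shortExact (W P : ℤ → ModuleCat.{u} A) (i : ∀ n, W (n + 1) ⟶ P n)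
    (p : ∀ n, P n ⟶ W n) (w : ∀ n, i n ≫ p n = 0) (hP : ∀ n, Projective (P n))
    (hS : ∀ n, (ShortComplex.mk (i n) (p n) (w n)).ShortExact)
    (hW : ∀ (n : ℤ) (Q : ModuleCat.{u} A), Projective Q → Subsingleton (Ext (W n) Q 1)) :
    IsTotallyAcyclic (ChainComplex.of P (fun n ↦ p (n + 1) ≫ i n) (fun n ↦ by
      rw [Category.assoc, reassoc_of% (w (n + 1)), Limits.zero_comp, Limits.comp_zero])) where
  projective n := hP n
  acyclic n := by
    obtain ⟨n, rfl⟩ : ∃ m, n = m + 1 := ⟨n - 1, by simp⟩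
    rw [HomologicalComplex.exactAt_iff' _ (n + 1 + 1) (n + 1) n (by simp) (by simp),
      ShortComplex.moduleCat_exact_iff]
    intro x hx
    simp only [HomologicalComplex.shortComplexFunctor'_obj_g, HomologicalComplex.shortComplexFunctor'_obj_f,
      ChainComplex.of_d] at hx ⊢
    have h1 : p (n + 1) x = 0 := by
      apply (hS n).moduleCat_injective_f
      rw [map_zero]
      exact hx
    obtain ⟨y, rfl⟩ := (ShortComplex.moduleCat_exact_iff _).1 (hS (n + 1)).exact x h1
    obtain ⟨z, rfl⟩ := (hS (n + 1 + 1)).moduleCat_surjective_g y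
    exact ⟨z, rfl⟩
  acyclic_hom Q hQ n := by
    obtain ⟨n, rfl⟩ : ∃ m, n = m + 1 := ⟨n - 1, by simp⟩
    rw [exactAt_linearYonedaObj_iff]
    intro (f : P (n + 1) ⟶ Q) hf
    rw [ChainComplex.of_d_succ, Category.assoc] at hf
    have := (hS (n + 1 + 1)).epi_g
    have := (hS (n + 1)).epi_g
    have hf' : i (n + 1) ≫ f = 0 := (cancel_epi (p (n + 1 + 1))).1 (by rw [hf, Limits.comp_zero])
    obtain ⟨g, rfl⟩ := (hS (n + 1)).exact.desc' f hf'
    obtain ⟨k, hk⟩ := (hS n).exists_extension Q (hW n Q hQ) g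
    refine ⟨k, ?_⟩
    rw [ChainComplex.of_d_succ, Category.assoc]
    exact congrArg (p (n + 1) ≫ ·) hk

theorem isGorensteinProjective_of_shortExact (W P : ℤ → ModuleCat.{u} A) (i : ∀ n, W (n + 1) ⟶ P n)
    (p : ∀ n, P n ⟶ W n) (w : ∀ n, i n ≫ p n = 0) (hP : ∀ n, Projective (P n))
    (hS : ∀ n, (ShortComplex.mk (i n) (p n) (w n)).ShortExact)
    (hW : ∀ (n : ℤ) (Q : ModuleCat.{u} A), Projective Q → Subsingleton (Ext (W n) Q 1)) :
    IsGorensteinProjective (W 1) := by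
  have h := isTotallyAcyclic_of_shortExact W P i p w hP hS hW
  generalize_proofs sq at h
  let C := ChainComplex.of P (fun n ↦ p (n + 1) ≫ i n) sq
  have key (n m k : ℤ) (hm : n + 1 = m) (hk : m + 1 = k) : Nonempty (C.cycles m ≅ W k) := by
    subst hm hk
    have := (hS n).mono_f
    have h₁ := C.cyclesIsKernel (n + 1) n (ComplexShape.next_eq' (.down ℤ) rfl)
    have h₂ := Limits.isKernelCompMono (h := C.d (n + 1) n) (hS (n + 1)).fIsKernel (i n)
      (ChainComplex.of_d_succ sq n)
    exact ⟨h₁.conePointUniqueUpToIso h₂⟩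
  exact ⟨C, h, key (-1) 0 1 rfl rfl⟩

/-- A class of modules which are `Ext`-orthogonal to projectives, and embed into projectives with
cokernels in the class, consists of Gorenstein-projective modules. -/
theorem isGorensteinProjective_of_class (P : ModuleCat.{u} A → Prop)
    (h₀ : ∀ K, P K → ExtProjVanishes 0 K)
    (h₁ : ∀ K, P K → ∃ (Q K' : ModuleCat.{u} A) (i : K ⟶ Q) (p : Q ⟶ K') (w : i ≫ p = 0),
      Projective Q ∧ P K' ∧ (ShortComplex.mk i p w).ShortExact)
    (K : ModuleCat.{u} A) (hK : P K) : IsGorensteinProjective K := by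
  have left (K : {K : ModuleCat.{u} A // ExtProjVanishes 0 K}) :
      ∃ (K' : {K : ModuleCat.{u} A // ExtProjVanishes 0 K}) (P : ModuleCat.{u} A)
        (i : K'.1 ⟶ P) (p : P ⟶ K.1) (w : i ≫ p = 0),
        Projective P ∧ (ShortComplex.mk i p w).ShortExact := by
    obtain ⟨K', P, i, p, w, hP, hS⟩ := exists_shortExact_projective K.1
    refine ⟨⟨K', fun Q hQ n hn ↦ ?_⟩, P, i, p, w, hP, hS⟩
    obtain ⟨n, rfl⟩ : ∃ m, n = m + 1 := ⟨n - 1, by lia⟩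
    exact hS.subsingleton_ext_X₁ Q _ (Ext.subsingleton_of_projective _ _ _)
      (K.2 Q hQ _ (by lia))
  have right (K : {K : ModuleCat.{u} A // P K}) :
      ∃ (K' : {K : ModuleCat.{u} A // P K}) (Q : ModuleCat.{u} A)
        (i : K.1 ⟶ Q) (p : Q ⟶ K'.1) (w : i ≫ p = 0),
        Projective Q ∧ (ShortComplex.mk i p w).ShortExact := by
    obtain ⟨Q, K', i, p, w, hQ, hK', hS⟩ := h₁ K.1 K.2
    exact ⟨⟨K', hK'⟩, Q, i, p, w, hQ, hS⟩
  choose l hl using left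
  choose r hr using right
  let a (n : ℕ) := l^[n] ⟨K, h₀ K hK⟩
  let b (n : ℕ) := r^[n] ⟨K, hK⟩
  -- The module `K` sits at index `1`, with syzygies above and cosyzygies in the class below. The
  -- two halves meet because `a 0` and `b 0` both have underlying module `K`.
  let W : ℤ → ModuleCat.{u} A
    | .ofNat 0 => (b 1).1
    | .ofNat (k + 1) => (a k).1
    | .negSucc k => (b (k + 2)).1
  have hW : ∀ n, ExtProjVanishes 0 (W n)
    | .ofNat 0 => h₀ _ (b 1).2
    | .ofNat (k + 1) => (a k).2
    | .negSucc k => h₀ _ (b (k + 2)).2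
  have hS : ∀ n, ∃ (P : ModuleCat.{u} A) (i : W (n + 1) ⟶ P) (p : P ⟶ W n) (w : i ≫ p = 0),
      Projective P ∧ (ShortComplex.mk i p w).ShortExact
    | .ofNat 0 => hr (b 0)
    | .ofNat (k + 1) => by
      have := hl (a k)
      rwa [← Function.iterate_succ_apply' l k] at this
    | .negSucc 0 => by
      have := hr (b 1)
      rwa [← Function.iterate_succ_apply' r 1] at this
    | .negSucc (k + 1) => by
      have := hr (b (k + 2))
      rwa [← Function.iterate_succ_apply' r (k + 2)] at this
  choose P i p w hP hS using hS
  exact isGorensteinProjective_of_shortExact W P i p w hP hS fun n Q hQ ↦ hW n Q hQ 1 zero_lt_one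

namespace IsTotallyAcyclic

variable {P : ChainComplex (ModuleCat.{u} A) ℤ} (hP : IsTotallyAcyclic P)

include hP

theorem shortExact {m n : ℤ} (h : n + 1 = m) :
    (ShortComplex.mk (P.iCycles m) (P.toCycles m n)
      (by rw [← cancel_mono (P.iCycles n)]; simp)).ShortExact where
  exact := ShortComplex.exact_of_f_is_kernel _ (Limits.isKernelOfComp (P.iCycles n) (P.d m n)
    (P.cyclesIsKernel m n (by simp [← h])) _ (by simp))
  mono_f := inferInstanceAs (Mono (P.iCycles m))
  epi_g := by
    exact Preadditive.epi_of_isZero_cokernel' _ (P.homologyIsCokernel m n (by simp [← h]))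
      ((P.exactAt_iff_isZero_homology n).1 (hP.acyclic n))

/-- A map from the cycles to `Q` becomes a cocycle of `Hom(P, Q)` after composition with
`P.toCycles`; that it is a coboundary says that the map extends. -/
theorem subsingleton_ext_one_cycles (n : ℤ) (Q : ModuleCat.{u} A) (hQ : Projective Q) :
    Subsingleton (Ext (P.cycles n) Q 1) := by
  have hp := hP.projective (n + 1)
  refine (hP.shortExact (m := n + 1) rfl).subsingleton_ext_one Q
    (Ext.subsingleton_of_projective _ _ _) fun (f : P.cycles (n + 1) ⟶ Q) ↦ ?_
  have h := (exactAt_linearYonedaObj_iff P Q (n + 1)).1 (hP.acyclic_hom Q hQ _)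
    (P.toCycles _ (n + 1) ≫ f) (by simp)
  obtain ⟨g, hg⟩ := h
  have := (hP.shortExact (m := n + 1 + 1) rfl).epi_g
  refine ⟨g, (cancel_epi (P.toCycles (n + 1 + 1) (n + 1))).1 ?_⟩
  simpa using hg

theorem extProjVanishes_cycles (n : ℤ) : ExtProjVanishes 0 (P.cycles n) := by
  intro Q hQ i hi
  obtain ⟨i, rfl⟩ : ∃ j, i = j + 1 := ⟨i - 1, by lia⟩
  induction i generalizing n with
  | zero => exact hP.subsingleton_ext_one_cycles n Q hQ
  | succ i ih =>
    have hp := hP.projective (n + 1)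
    exact (hP.shortExact (m := n + 1) rfl).subsingleton_ext_X₃ Q (i + 1) (ih (n + 1) (by simp))
      (Ext.subsingleton_of_projective _ _ _)

end IsTotallyAcyclic

theorem CategoryTheory.ShortComplex.ShortExact.comp_iso {K K' Q M : ModuleCat.{u} A} {i : K ⟶ Q}
    {p : Q ⟶ M} {w : i ≫ p = 0} (hS : (ShortComplex.mk i p w).ShortExact) (e : K' ≅ K) :
    (ShortComplex.mk (e.hom ≫ i) p (by rw [Category.assoc, w, Limits.comp_zero])).ShortExact :=
  ShortComplex.shortExact_of_iso
    (ShortComplex.isoMk (S₁ := .mk i p w) (S₂ := .mk (e.hom ≫ i) p _) e.symm (Iso.refl _) (Iso.refl _) (by simp) (by simp)) hS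

namespace IsGorensteinProjective

theorem extProjVanishes {M : ModuleCat.{u} A} (hM : IsGorensteinProjective M) :
    ExtProjVanishes 0 M := by
  obtain ⟨P, hP, ⟨e⟩⟩ := hM
  exact fun Q hQ i hi ↦ (Retract.ofIso e.symm).subsingleton_ext Q i
    (hP.extProjVanishes_cycles 0 Q hQ i hi)

/-- The cokernel of `Z₀ → P₀` is again a cycle module of the complex, and the class of all its cycle
modules satisfies `isGorensteinProjective_of_class`, which avoids shifting complexes. -/
theorem exists_shortExact {M : ModuleCat.{u} A} (hM : IsGorensteinProjective M) :
    ∃ (Q M' : ModuleCat.{u} A) (i : M ⟶ Q) (p : Q ⟶ M') (w : i ≫ p = 0),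
      Projective Q ∧ IsGorensteinProjective M' ∧ (ShortComplex.mk i p w).ShortExact := by
  obtain ⟨P, hP, ⟨e⟩⟩ := hM
  have h (n : ℤ) (K : ModuleCat.{u} A) (e : K ≅ P.cycles n) :
      ∃ (Q K' : ModuleCat.{u} A) (i : K ⟶ Q) (p : Q ⟶ K') (w : i ≫ p = 0),
      Projective Q ∧ (∃ m, Nonempty (K' ≅ P.cycles m)) ∧ (ShortComplex.mk i p w).ShortExact :=
    ⟨_, _, _, _, _, hP.projective n, ⟨n - 1, ⟨Iso.refl _⟩⟩,
      (hP.shortExact (sub_add_cancel n 1)).comp_iso e⟩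
  obtain ⟨Q, K', i, p, w, hQ, hK', hS⟩ := h 0 M e.symm
  refine ⟨Q, K', i, p, w, hQ, isGorensteinProjective_of_class
    (fun K ↦ ∃ m, Nonempty (K ≅ P.cycles m)) ?_ (fun K ⟨m, ⟨e⟩⟩ ↦ h m K e) K' hK', hS⟩
  exact fun K ⟨m, ⟨e⟩⟩ Q hQ i hi ↦ (Retract.ofIso e).subsingleton_ext Q i
    (hP.extProjVanishes_cycles m Q hQ i hi)

end IsGorensteinProjective

end GorensteinProjective

/-! ### Pushouts, pullbacks and composites of short exact sequences. -/

section Sequences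

variable {A : Type u} [Ring A]

namespace ModuleCat

variable {K E N L C Q : ModuleCat.{u} A} {i : K ⟶ E} {p : E ⟶ N} {w : i ≫ p = 0}

theorem shortExact_mk (hi : ∀ x, i x = 0 → x = 0) (hex : ∀ y, p y = 0 → ∃ x, i x = y)
    (hp : ∀ z, ∃ y, p y = z) : (ShortComplex.mk i p w).ShortExact :=
  shortComplex_shortExact _ (fun y ↦ ⟨hex y, fun ⟨x, hx⟩ ↦ by
    rw [← hx]; exact ConcreteCategory.congr_hom w x⟩) ((injective_iff_map_eq_zero _).2 hi) hp

theorem apply_apply_of_shortExact (_ : (ShortComplex.mk i p w).ShortExact) (x : K) :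
    p (i x) = 0 := ConcreteCategory.congr_hom w x

variable (hS : (ShortComplex.mk i p w).ShortExact)

include hS

theorem eq_zero_of_shortExact {x : K} (hx : i x = 0) : x = 0 :=
  hS.moduleCat_injective_f (hx.trans (map_zero _).symm)

theorem exists_of_shortExact {y : E} (hy : p y = 0) : ∃ x, i x = y :=
  (ShortComplex.moduleCat_exact_iff _).1 hS.exact y hy

theorem exists_apply_of_shortExact (z : N) : ∃ y, p y = z := hS.moduleCat_surjective_g z

theorem exists_pushout {f : K ⟶ L} {c : L ⟶ C} {w' : f ≫ c = 0}
    (hS' : (ShortComplex.mk f c w').ShortExact) :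
    ∃ (W : ModuleCat.{u} A) (a : E ⟶ W) (b : L ⟶ W) (q : W ⟶ N) (r : W ⟶ C) (h : b ≫ q = 0)
      (h' : a ≫ r = 0), (ShortComplex.mk b q h).ShortExact ∧
        (ShortComplex.mk a r h').ShortExact := by
  let D : Submodule A (E × L) := LinearMap.range (LinearMap.prod i.hom (-f.hom))
  let W : ModuleCat.{u} A := ModuleCat.of A ((E × L) ⧸ D)
  have hD (e : E) (l : L) : (D.mkQ (e, l) = 0) ↔ ∃ k, i k = e ∧ -f k = l := by
    rw [Submodule.mkQ_apply, Submodule.Quotient.mk_eq_zero]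
    simp [D]
  let a : E ⟶ W := ModuleCat.ofHom (D.mkQ ∘ₗ LinearMap.inl A E L)
  let b : L ⟶ W := ModuleCat.ofHom (D.mkQ ∘ₗ LinearMap.inr A E L)
  let q : W ⟶ N := ModuleCat.ofHom (D.liftQ (p.hom ∘ₗ LinearMap.fst A E L) (by
    rintro _ ⟨k, rfl⟩
    exact apply_apply_of_shortExact hS k))
  let r : W ⟶ C := ModuleCat.ofHom (D.liftQ (c.hom ∘ₗ LinearMap.snd A E L) (by
    rintro _ ⟨k, rfl⟩
    change c (-f k) = 0
    rw [map_neg, apply_apply_of_shortExact hS' k, neg_zero]))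
  have hq (e : E) (l : L) : q (D.mkQ (e, l)) = p e := rfl
  have hr (e : E) (l : L) : r (D.mkQ (e, l)) = c l := rfl
  have ha (e : E) : a e = D.mkQ (e, 0) := rfl
  have hb (l : L) : b l = D.mkQ (0, l) := rfl
  have hab (e : E) (l : L) : D.mkQ (e, l) = a e + b l := by
    rw [ha, hb, ← map_add, Prod.mk_add_mk, add_zero, zero_add]
  have hai (k : K) : a (i k) = b (f k) := by
    rw [← sub_eq_zero, sub_eq_add_neg, ← map_neg, ← hab, hD]
    exact ⟨k, rfl, rfl⟩
  refine ⟨W, a, b, q, r, ?_, ?_, shortExact_mk ?_ ?_ ?_, shortExact_mk ?_ ?_ ?_⟩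
  · ext l; exact (hq 0 l).trans (map_zero _)
  · ext e; exact (hr e 0).trans (map_zero _)
  · intro l hl
    obtain ⟨k, hk, rfl⟩ := (hD _ _).1 hl
    rw [eq_zero_of_shortExact hS hk, map_zero, neg_zero]
  · intro y hy
    obtain ⟨⟨e, l⟩, rfl⟩ := D.mkQ_surjective y
    obtain ⟨k, rfl⟩ := exists_of_shortExact hS (y := e) hy
    exact ⟨f k + l, by rw [map_add, ← hai, ← hab]⟩
  · intro z
    obtain ⟨e, rfl⟩ := exists_apply_of_shortExact hS z
    exact ⟨a e, rfl⟩
  · intro e he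
    obtain ⟨k, rfl, hk⟩ := (hD _ _).1 he
    rw [eq_zero_of_shortExact hS' (neg_eq_zero.1 hk), map_zero]
  · intro y hy
    obtain ⟨⟨e, l⟩, rfl⟩ := D.mkQ_surjective y
    obtain ⟨k, rfl⟩ := exists_of_shortExact hS' (y := l) hy
    exact ⟨e + i k, by rw [map_add, hai, ← hab]⟩
  · intro z
    obtain ⟨l, rfl⟩ := exists_apply_of_shortExact hS' z
    exact ⟨b l, rfl⟩

/-- The retraction identifies `E` with `K × N`, after which only `N` has to be embedded. -/
theorem exists_shortExact_lift_prod {f : N ⟶ Q} {c : Q ⟶ C} {w' : f ≫ c = 0}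
    (hS' : (ShortComplex.mk f c w').ShortExact) {ρ : E ⟶ K} (hρ : i ≫ ρ = 𝟙 K) :
    ∃ (j : E ⟶ ModuleCat.of A (K × Q)) (r : ModuleCat.of A (K × Q) ⟶ C) (h : j ≫ r = 0),
      (ShortComplex.mk j r h).ShortExact := by
  have hρ' (x : K) : ρ (i x) = x := ConcreteCategory.congr_hom hρ x
  refine ⟨ModuleCat.ofHom (LinearMap.prod ρ.hom (p ≫ f).hom),
    ModuleCat.ofHom (c.hom ∘ₗ LinearMap.snd A K Q), ?_, shortExact_mk ?_ ?_ ?_⟩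
  · ext x
    exact apply_apply_of_shortExact hS' (p x)
  · intro x hx
    have h₁ : ρ x = 0 := congrArg Prod.fst hx
    have h₂ : f (p x) = 0 := congrArg Prod.snd hx
    obtain ⟨y, rfl⟩ := exists_of_shortExact hS (eq_zero_of_shortExact hS' h₂)
    rw [hρ'] at h₁
    rw [h₁, map_zero]
  · rintro ⟨y, z⟩ (hyz : c z = 0)
    obtain ⟨z, rfl⟩ := exists_of_shortExact hS' hyz
    obtain ⟨x, rfl⟩ := exists_apply_of_shortExact hS z
    refine ⟨x + i (y - ρ x), Prod.ext ?_ ?_⟩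
    · change ρ (x + i (y - ρ x)) = y
      rw [map_add, hρ', add_sub_cancel]
    · change f (p (x + i (y - ρ x))) = f (p x)
      rw [map_add, apply_apply_of_shortExact hS, add_zero]
  · intro z
    obtain ⟨y, rfl⟩ := exists_apply_of_shortExact hS' z
    exact ⟨(0, y), rfl⟩

theorem exists_pullback {j : L ⟶ Q} {f : Q ⟶ N} {w' : j ≫ f = 0}
    (hS' : (ShortComplex.mk j f w').ShortExact) :
    ∃ (W : ModuleCat.{u} A) (a : K ⟶ W) (b : L ⟶ W) (q : W ⟶ Q) (r : W ⟶ E) (h : a ≫ q = 0)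
      (h' : b ≫ r = 0), (ShortComplex.mk a q h).ShortExact ∧
        (ShortComplex.mk b r h').ShortExact := by
  let D : Submodule A (E × Q) :=
    LinearMap.ker (p.hom ∘ₗ LinearMap.fst A E Q - f.hom ∘ₗ LinearMap.snd A E Q)
  have hD (e : E) (x : Q) : (e, x) ∈ D ↔ p e = f x := by
    simp [D, sub_eq_zero]
  let W : ModuleCat.{u} A := ModuleCat.of A D
  let a : K ⟶ W := ModuleCat.ofHom ((LinearMap.inl A E Q ∘ₗ i.hom).codRestrict D fun k ↦
    (hD _ _).2 ((apply_apply_of_shortExact hS k).trans (map_zero _).symm))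
  let b : L ⟶ W := ModuleCat.ofHom ((LinearMap.inr A E Q ∘ₗ j.hom).codRestrict D fun l ↦
    (hD _ _).2 ((map_zero _).trans (apply_apply_of_shortExact hS' l).symm))
  let q : W ⟶ Q := ModuleCat.ofHom (LinearMap.snd A E Q ∘ₗ D.subtype)
  let r : W ⟶ E := ModuleCat.ofHom (LinearMap.fst A E Q ∘ₗ D.subtype)
  refine ⟨W, a, b, q, r, rfl, rfl, shortExact_mk ?_ ?_ ?_, shortExact_mk ?_ ?_ ?_⟩
  · exact fun k hk ↦ eq_zero_of_shortExact hS (congrArg (fun x : W ↦ x.1.1) hk)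
  · rintro ⟨⟨e, x⟩, hex⟩ (rfl : x = 0)
    obtain ⟨k, rfl⟩ := exists_of_shortExact hS (((hD _ _).1 hex).trans (map_zero _))
    exact ⟨k, rfl⟩
  · intro x
    obtain ⟨e, he⟩ := exists_apply_of_shortExact hS (f x)
    exact ⟨⟨(e, x), (hD _ _).2 he⟩, rfl⟩
  · exact fun l hl ↦ eq_zero_of_shortExact hS' (congrArg (fun x : W ↦ x.1.2) hl)
  · rintro ⟨⟨e, x⟩, hex⟩ (rfl : e = 0)
    obtain ⟨k, rfl⟩ := exists_of_shortExact hS' (((hD _ _).1 hex).symm.trans (map_zero _))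
    exact ⟨k, rfl⟩
  · intro e
    obtain ⟨x, hx⟩ := exists_apply_of_shortExact hS' (p e)
    exact ⟨⟨(e, x), (hD _ _).2 hx.symm⟩, rfl⟩

theorem exists_shortExact_comp_mono {j : E ⟶ Q} {q : Q ⟶ C} {w' : j ≫ q = 0}
    (hS' : (ShortComplex.mk j q w').ShortExact) :
    ∃ (Y : ModuleCat.{u} A) (π : Q ⟶ Y) (n : N ⟶ Y) (r : Y ⟶ C) (h : (i ≫ j) ≫ π = 0)
      (h' : n ≫ r = 0), (ShortComplex.mk (i ≫ j) π h).ShortExact ∧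
        (ShortComplex.mk n r h').ShortExact := by
  have := hS.mono_f
  have := hS.epi_g
  have := hS'.mono_f
  have := hS'.epi_g
  have hm : Mono (i ≫ j) := mono_comp i j
  have hS'' : (ShortComplex.mk _ _ (Limits.cokernel.condition (i ≫ j))).ShortExact :=
    { exact := ShortComplex.exact_cokernel (i ≫ j) }
  obtain ⟨n, hn⟩ := hS.exact.desc' (j ≫ Limits.cokernel.π (i ≫ j)) (by
    have := Limits.cokernel.condition (i ≫ j)
    rwa [Category.assoc] at this)
  obtain ⟨r, hr⟩ := hS''.exact.desc' q (by
    change (i ≫ j) ≫ q = 0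
    rw [Category.assoc, w', Limits.comp_zero])
  have hn' (e : E) : n (p e) = Limits.cokernel.π (i ≫ j) (j e) := ConcreteCategory.congr_hom hn e
  have hr' (x : Q) : r (Limits.cokernel.π (i ≫ j) x) = q x := ConcreteCategory.congr_hom hr x
  refine ⟨_, Limits.cokernel.π (i ≫ j), n, r, Limits.cokernel.condition _, ?_, hS'',
    shortExact_mk ?_ ?_ ?_⟩
  · ext x
    obtain ⟨e, rfl⟩ := exists_apply_of_shortExact hS x
    change r (n (p e)) = 0
    rw [hn', hr', apply_apply_of_shortExact hS']
  · intro x hx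
    obtain ⟨e, rfl⟩ := exists_apply_of_shortExact hS x
    rw [hn'] at hx
    obtain ⟨k, hk⟩ := exists_of_shortExact hS'' hx
    rw [← hS'.moduleCat_injective_f (a₁ := i k) (a₂ := e) hk, apply_apply_of_shortExact hS]
  · intro y hy
    obtain ⟨x, rfl⟩ := exists_apply_of_shortExact hS'' y
    rw [hr'] at hy
    obtain ⟨e, rfl⟩ := exists_of_shortExact hS' hy
    exact ⟨p e, hn' e⟩
  · intro z
    obtain ⟨x, rfl⟩ := exists_apply_of_shortExact hS' z
    exact ⟨_, hr' x⟩

theorem exists_shortExact_comp_epi {j : L ⟶ N} {q : N ⟶ C} {w' : j ≫ q = 0}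
    (hS' : (ShortComplex.mk j q w').ShortExact) :
    ∃ (Y : ModuleCat.{u} A) (ι : Y ⟶ E) (n : K ⟶ Y) (r : Y ⟶ L) (h : ι ≫ p ≫ q = 0)
      (h' : n ≫ r = 0), (ShortComplex.mk ι (p ≫ q) h).ShortExact ∧
        (ShortComplex.mk n r h').ShortExact := by
  have := hS.mono_f
  have := hS.epi_g
  have := hS'.mono_f
  have := hS'.epi_g
  have hm : Epi (p ≫ q) := epi_comp p q
  have hS'' : (ShortComplex.mk _ _ (Limits.kernel.condition (p ≫ q))).ShortExact :=
    { exact := ShortComplex.exact_kernel (p ≫ q) }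
  obtain ⟨n, hn⟩ := hS''.exact.lift' i (by
    change i ≫ p ≫ q = 0
    rw [reassoc_of% w, Limits.zero_comp])
  obtain ⟨r, hr⟩ := hS'.exact.lift' (Limits.kernel.ι (p ≫ q) ≫ p) (by
    have := Limits.kernel.condition (p ≫ q)
    rwa [← Category.assoc] at this)
  have hn' (e : K) : Limits.kernel.ι (p ≫ q) (n e) = i e := ConcreteCategory.congr_hom hn e
  have hr' (x : (Limits.kernel (p ≫ q) : ModuleCat.{u} A)) :
      j (r x) = p (Limits.kernel.ι (p ≫ q) x) := ConcreteCategory.congr_hom hr x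
  refine ⟨_, Limits.kernel.ι (p ≫ q), n, r, Limits.kernel.condition _, ?_, hS'',
    shortExact_mk ?_ ?_ ?_⟩
  · rw [← cancel_mono j, Category.assoc, hr, Limits.zero_comp]
    change n ≫ Limits.kernel.ι (p ≫ q) ≫ p = 0
    rw [reassoc_of% hn, w]
  · intro x hx
    refine eq_zero_of_shortExact hS ?_
    rw [← hn', hx, map_zero]
  · intro y hy
    have h := hr' y
    rw [hy, map_zero] at h
    obtain ⟨x, hx⟩ := exists_of_shortExact hS h.symm
    exact ⟨x, hS''.moduleCat_injective_f ((hn' x).trans hx)⟩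
  · intro z
    obtain ⟨e, he⟩ := exists_apply_of_shortExact hS (j z)
    have : (p ≫ q) e = 0 := by
      change q (p e) = 0
      rw [he, apply_apply_of_shortExact hS']
    obtain ⟨y, rfl⟩ := exists_of_shortExact hS'' this
    exact ⟨y, hS'.moduleCat_injective_f ((hr' y).trans he)⟩

end ModuleCat

end Sequences

/-! ### Closure of Gorenstein-projectives under extensions and summands. -/

section Closure

open Abelian Limits

variable {A : Type u} [Ring A]

/-- The smallest class of modules containing a given one and closed under extensions. -/
inductive ExtensionClosure (P : ModuleCat.{u} A → Prop) : ModuleCat.{u} A → Prop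
  | of {M : ModuleCat.{u} A} (hM : P M) : ExtensionClosure P M
  | ext {K E N : ModuleCat.{u} A} {i : K ⟶ E} {p : E ⟶ N} {w : i ≫ p = 0}
      (hS : (ShortComplex.mk i p w).ShortExact) (hK : ExtensionClosure P K)
      (hN : ExtensionClosure P N) : ExtensionClosure P E

theorem IsGorensteinProjective.of_iso {M N : ModuleCat.{u} A} (e : M ≅ N)
    (hM : IsGorensteinProjective M) : IsGorensteinProjective N := by
  obtain ⟨P, hP, ⟨e'⟩⟩ := hM
  exact ⟨P, hP, ⟨e' ≪≫ e⟩⟩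

theorem ExtProjVanishes.ext {k : ℕ} {K E N : ModuleCat.{u} A} {i : K ⟶ E} {p : E ⟶ N}
    {w : i ≫ p = 0} (hS : (ShortComplex.mk i p w).ShortExact) (hK : ExtProjVanishes k K)
    (hN : ExtProjVanishes k N) : ExtProjVanishes k E :=
  fun Q hQ n hn ↦ hS.subsingleton_ext_X₂ Q n (hK Q hQ n hn) (hN Q hQ n hn)

theorem ExtProjVanishes.retract {k : ℕ} {M N : ModuleCat.{u} A} (r : Retract M N)
    (hN : ExtProjVanishes k N) : ExtProjVanishes k M :=
  fun Q hQ n hn ↦ r.subsingleton_ext Q n (hN Q hQ n hn)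

/-- The direct summands of Gorenstein-projective modules. -/
def IsGPSummand (M : ModuleCat.{u} A) : Prop :=
  ∃ M' : ModuleCat.{u} A, IsGorensteinProjective (M ⊞ M')

theorem IsGorensteinProjective.isGPSummand {M : ModuleCat.{u} A} (hM : IsGorensteinProjective M) :
    IsGPSummand M :=
  ⟨ModuleCat.of A PUnit, hM.of_iso (isoBiprodZero (ModuleCat.isZero_of_subsingleton _))⟩

/-- Treating summands and extensions together matters: the cokernel of a summand embedded in a
projective is only seen to be an extension of a Gorenstein-projective by the complementary summand.
-/
theorem isGorensteinProjective_of_extensionClosure {M : ModuleCat.{u} A}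
    (hM : ExtensionClosure IsGPSummand M) : IsGorensteinProjective M := by
  have h₀ (K : ModuleCat.{u} A) (hK : ExtensionClosure IsGPSummand K) : ExtProjVanishes 0 K := by
    induction hK with
    | of h =>
      obtain ⟨M', hM⟩ := h
      exact hM.extProjVanishes.retract ⟨biprod.inl, biprod.fst, by simp⟩
    | ext hS _ _ hK hN => exact .ext hS hK hN
  refine isGorensteinProjective_of_class _ h₀ (fun K hK ↦ ?_) M hM
  induction hK with
  | @of M h =>
    obtain ⟨M', hM⟩ := h
    obtain ⟨Q, C, i, p, w, hQ, hC, hS⟩ := hM.exists_shortExact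
    have hS' := (ShortComplex.Splitting.ofHasBinaryBiproduct M M').shortExact
    -- The cokernel `Y` of `M → M ⊞ M' → Q` fits into `M' → Y → C`.
    obtain ⟨Y, π, n, r, h, h', h₁, h₂⟩ := ModuleCat.exists_shortExact_comp_mono hS' hS
    have hM' : IsGPSummand M' := ⟨M, hM.of_iso (biprod.braiding M M')⟩
    exact ⟨Q, Y, _, π, h, hQ, .ext h₂ (.of hM') (.of hC.isGPSummand), h₁⟩
  | @ext K E N i p w hS hK hN ihK ihN =>
    obtain ⟨Q₁, C₁, i₁, p₁, w₁, hQ₁, hC₁, hS₁⟩ := ihK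
    obtain ⟨Q₂, C₂, i₂, p₂, w₂, hQ₂, hC₂, hS₂⟩ := ihN
    -- Horseshoe argument: the pushout `W` is an extension of `N` by `Q₁`, which splits since
    -- `Ext¹(N, Q₁) = 0`. So `E ↪ W ↪ Q₁ × Q₂`, with cokernel an extension of `C₂` by `C₁`.
    obtain ⟨W, a, b, q, r, h, h', hW, hW'⟩ := ModuleCat.exists_pushout hS hS₁
    obtain ⟨ρ, hρ⟩ := hW.exists_extension Q₁ (h₀ N hN Q₁ hQ₁ 1 zero_lt_one) (𝟙 _)
    obtain ⟨j, s, hjs, hQ⟩ := ModuleCat.exists_shortExact_lift_prod hW hS₂ hρ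
    obtain ⟨Y, π, n, t, h₁, h₂, hY, hY'⟩ := ModuleCat.exists_shortExact_comp_mono hW' hQ
    have : Projective (ModuleCat.of A (Q₁ × Q₂)) := inferInstance
    exact ⟨_, Y, _, π, h₁, this, .ext hY' hC₁ hC₂, hY⟩

theorem IsGPSummand.isGorensteinProjective {M : ModuleCat.{u} A} (hM : IsGPSummand M) :
    IsGorensteinProjective M := isGorensteinProjective_of_extensionClosure (.of hM)

theorem IsGorensteinProjective.ext {K E N : ModuleCat.{u} A} {i : K ⟶ E} {p : E ⟶ N}
    {w : i ≫ p = 0} (hS : (ShortComplex.mk i p w).ShortExact) (hK : IsGorensteinProjective K)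
    (hN : IsGorensteinProjective N) : IsGorensteinProjective E :=
  isGorensteinProjective_of_extensionClosure (.ext hS (.of hK.isGPSummand) (.of hN.isGPSummand))

end Closure

/-! ### Finite projective dimension and special precovers. -/

section FiniteDimension

open Abelian

variable {A : Type u} [Ring A]

/-- Modules of finite projective dimension. -/
def HasFiniteProjectiveDimension (M : ModuleCat.{u} A) : Prop :=
  ∃ m, HasProjectiveDimensionLT M (m + 1)

namespace HasFiniteProjectiveDimension

variable {K E N : ModuleCat.{u} A} {i : K ⟶ E} {p : E ⟶ N} {w : i ≫ p = 0}

theorem of_projective (hN : Projective N) : HasFiniteProjectiveDimension N :=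
  ⟨0, inferInstance⟩

theorem retract (r : Retract K E) (hE : HasFiniteProjectiveDimension E) :
    HasFiniteProjectiveDimension K := by
  obtain ⟨m, hm⟩ := hE
  exact ⟨m, r.hasProjectiveDimensionLT (m + 1)⟩

theorem middle (hS : (ShortComplex.mk i p w).ShortExact) (hK : HasFiniteProjectiveDimension K)
    (hN : HasFiniteProjectiveDimension N) : HasFiniteProjectiveDimension E := by
  obtain ⟨a, ha⟩ := hK
  obtain ⟨b, hb⟩ := hN
  exact ⟨max a b, hS.hasProjectiveDimensionLT_X₂ _
    (hasProjectiveDimensionLT_of_ge K (a + 1) _ (by lia))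
    (hasProjectiveDimensionLT_of_ge N (b + 1) _ (by lia))⟩

theorem left (hS : (ShortComplex.mk i p w).ShortExact) (hE : HasFiniteProjectiveDimension E)
    (hN : HasFiniteProjectiveDimension N) : HasFiniteProjectiveDimension K := by
  obtain ⟨a, ha⟩ := hE
  obtain ⟨b, hb⟩ := hN
  exact ⟨max a b, hS.hasProjectiveDimensionLT_X₁ _
    (hasProjectiveDimensionLT_of_ge E (a + 1) _ (by lia))
    (hasProjectiveDimensionLT_of_ge N (b + 1) _ (by lia))⟩

theorem right (hS : (ShortComplex.mk i p w).ShortExact) (hK : HasFiniteProjectiveDimension K)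
    (hE : HasFiniteProjectiveDimension E) : HasFiniteProjectiveDimension N := by
  obtain ⟨a, ha⟩ := hK
  obtain ⟨b, hb⟩ := hE
  exact ⟨max a b + 1, hS.hasProjectiveDimensionLT_X₃ _
    (hasProjectiveDimensionLT_of_ge K (a + 1) _ (by lia))
    (hasProjectiveDimensionLT_of_ge E (b + 1) _ (by lia))⟩

/-- The projective dimension, if finite, is detected by the extensions with projective modules. -/
theorem hasProjectiveDimensionLT {M : ModuleCat.{u} A} (hM : HasFiniteProjectiveDimension M)
    {k : ℕ} (hk : ExtProjVanishes k M) : HasProjectiveDimensionLT M (k + 1) := by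
  obtain ⟨m, hm⟩ := hM
  induction m with
  | zero => exact hasProjectiveDimensionLT_of_ge M 1 _ (by lia)
  | succ m ih =>
    by_cases hmk : m < k
    · exact hasProjectiveDimensionLT_of_ge M (m + 1 + 1) _ (by lia)
    -- `Ext^(m+1)(M, X)` lies between `Ext^(m+1)(M, P)`, zero since `m + 1 > k`, and `Ext^(m+2)(M,
    -- Y)`, zero by the current bound; so the bound drops by one.
    · refine ih (hasProjectiveDimensionLT_of_enoughInjectives M (m + 1) fun X ↦ ?_)
      obtain ⟨Y, P, i, p, w, hP, hS⟩ := exists_shortExact_projective X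
      exact hS.subsingleton_ext_of_X₁_X₂ M (m + 1)
        (HasProjectiveDimensionLT.subsingleton M (m + 1 + 1) _ le_rfl Y) (hk P hP _ (by lia))

theorem projective {M : ModuleCat.{u} A} (hM : HasFiniteProjectiveDimension M)
    (h : ExtProjVanishes 0 M) : Projective M :=
  projective_iff_hasProjectiveDimensionLT_one.2 (hM.hasProjectiveDimensionLT h)

/-- Dimension shift along a projective resolution of `M`. This is what makes precovers with kernel
of finite projective dimension proper. -/
theorem subsingleton_ext {M X : ModuleCat.{u} A} (hM : HasFiniteProjectiveDimension M)
    (hX : ExtProjVanishes 0 X) (i : ℕ) (hi : 0 < i) : Subsingleton (Ext X M i) := by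
  obtain ⟨m, hm⟩ := hM
  induction m generalizing M i with
  | zero => exact hX M (projective_iff_hasProjectiveDimensionLT_one.2 hm) i hi
  | succ m ih =>
    obtain ⟨Y, P, j, p, w, hP, hS⟩ := exists_shortExact_projective M
    exact hS.subsingleton_ext_of_X₁_X₂ X i
      (ih (i + 1) (by lia) ((hS.hasProjectiveDimensionLT_X₃_iff m hP).1 hm)) (hX P hP i hi)

end HasFiniteProjectiveDimension

/-- If injective modules have projective dimension at most `p`, finite injective dimensions are
at most `p`. -/
theorem hasInjectiveDimensionLT_of_injective_bound {p : ℕ}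
    (hI : ∀ J : ModuleCat.{u} A, Injective J → HasProjectiveDimensionLT J (p + 1))
    (M : ModuleCat.{u} A) (m : ℕ) (hM : HasInjectiveDimensionLT M (m + 1)) :
    HasInjectiveDimensionLT M (p + 1) := by
  induction m with
  | zero => exact hasInjectiveDimensionLT_of_ge M 1 _ (by lia)
  | succ m ih =>
    by_cases hmk : m < p
    · exact hasInjectiveDimensionLT_of_ge M (m + 1 + 1) _ (by lia)
    · refine ih (hasInjectiveDimensionLT_of_enoughProjectives M (m + 1) fun X ↦ ?_)
      obtain ⟨I, Y, i, q, w, hJ, hS⟩ := exists_shortExact_injective X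
      have := hI I hJ
      exact hS.subsingleton_ext_X₁ M (m + 1)
        (HasProjectiveDimensionLT.subsingleton I (p + 1) _ (by lia) M)
        (HasInjectiveDimensionLT.subsingleton M (m + 1 + 1) _ le_rfl Y)

theorem ExtProjVanishes.of_hasInjectiveDimensionLT {n : ℕ}
    (hQ : ∀ Q : ModuleCat.{u} A, Projective Q → HasInjectiveDimensionLT Q (n + 1))
    (M : ModuleCat.{u} A) : ExtProjVanishes n M := fun Q h i hi ↦
  have := hQ Q h
  HasInjectiveDimensionLT.subsingleton Q (n + 1) i hi M

theorem ExtProjVanishes.left {k l : ℕ} {K E N : ModuleCat.{u} A} {i : K ⟶ E} {p : E ⟶ N}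
    {w : i ≫ p = 0} (hS : (ShortComplex.mk i p w).ShortExact) (hE : ExtProjVanishes l E)
    (hN : ExtProjVanishes k N) (hkl : k ≤ l + 1) : ExtProjVanishes l K :=
  fun Q hQ n hn ↦ hS.subsingleton_ext_X₁ Q n (hE Q hQ n hn) (hN Q hQ _ (by lia))

theorem ExtProjVanishes.of_projective {P : ModuleCat.{u} A} (hP : Projective P) (k : ℕ) :
    ExtProjVanishes k P := fun Q _ i hi ↦ by
  obtain ⟨i, rfl⟩ : ∃ j, i = j + 1 := ⟨i - 1, by lia⟩
  exact Ext.subsingleton_of_projective P Q i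

section Gorenstein

variable {n : ℕ} (hQ : ∀ Q : ModuleCat.{u} A, Projective Q → HasInjectiveDimensionLT Q (n + 1))
  (hI : ∀ J : ModuleCat.{u} A, Injective J → HasFiniteProjectiveDimension J)

include hQ hI

/-- Each induction step replaces `G` by a syzygy, which lowers the degree above which Ext into
projectives vanishes; the trivial cover by `M` itself starts the induction. -/
theorem exists_special_precover_aux (t : ℕ) (M : ModuleCat.{u} A) :
    ∃ (Y G : ModuleCat.{u} A) (i : Y ⟶ G) (p : G ⟶ M) (w : i ≫ p = 0),
      (ShortComplex.mk i p w).ShortExact ∧ HasFiniteProjectiveDimension Y ∧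
        ExtProjVanishes (n - t) G := by
  induction t generalizing M with
  | zero =>
    refine ⟨ModuleCat.of A PUnit, M, 0, 𝟙 M, Limits.zero_comp,
      ModuleCat.shortExact_mk (fun x _ ↦ Subsingleton.elim _ _) (fun y hy ↦ ⟨0, hy.symm⟩)
        fun z ↦ ⟨z, rfl⟩, .of_projective inferInstance, .of_hasInjectiveDimensionLT hQ M⟩
  | succ t ih =>
    obtain ⟨I, M', i, p, w, hJ, hS⟩ := exists_shortExact_injective M
    obtain ⟨Y', G', i', p', w', hS', hY', hG'⟩ := ih M'
    -- The pullback `W` of `I` and `G'` over `M'` has finite projective dimension, as an extension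
    -- of `I` by `Y'`. The new `G` is the preimage of `M ⊆ W` in a projective `P` onto `W`: it is a
    -- syzygy of `G'` and maps onto `M` with kernel `Y`.
    obtain ⟨W, a, b, q, r, h, h', h₁, h₂⟩ := ModuleCat.exists_pullback hS hS'
    have hW : HasFiniteProjectiveDimension W := .middle h₂ hY' (hI I hJ)
    obtain ⟨Y, P, j, s, hjs, hP, h₃⟩ := exists_shortExact_projective W
    obtain ⟨G, ι, m, s', h₄, h₅, hG, hY⟩ := ModuleCat.exists_shortExact_comp_epi h₃ h₁
    exact ⟨Y, G, m, s', h₅, hY, .left h₃ (.of_projective hP) hW,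
      .left hG (.of_projective hP _) hG' (by lia)⟩

theorem exists_special_precover (M : ModuleCat.{u} A) :
    ∃ (Y G : ModuleCat.{u} A) (i : Y ⟶ G) (p : G ⟶ M) (w : i ≫ p = 0),
      (ShortComplex.mk i p w).ShortExact ∧ HasFiniteProjectiveDimension Y ∧
        ExtProjVanishes 0 G := by
  simpa using exists_special_precover_aux hQ hI n M

/-- The pullback of an injective hull sequence and a special precover embeds `K` into `W`, which has
finite projective dimension and no Ext into projectives. Hence `W` is projective, and its quotient
`G` is again in the class. -/
theorem ExtProjVanishes.isGorensteinProjective {M : ModuleCat.{u} A} (hM : ExtProjVanishes 0 M) :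
    IsGorensteinProjective M := by
  refine isGorensteinProjective_of_class (ExtProjVanishes 0) (fun _ h ↦ h) (fun K hK ↦ ?_) M hM
  obtain ⟨I, K', i, p, w, hJ, hS⟩ := exists_shortExact_injective K
  obtain ⟨Y, G, i', p', w', hS', hY, hG⟩ := exists_special_precover hQ hI K'
  obtain ⟨W, a, b, q, r, h, h', h₁, h₂⟩ := ModuleCat.exists_pullback hS hS'
  exact ⟨W, G, a, q, h, (HasFiniteProjectiveDimension.middle h₂ hY (hI I hJ)).projective
    (.ext h₁ hK hG), hG, h₁⟩

end Gorenstein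

end FiniteDimension

/-! ### Proper resolutions from iterated precovers. -/

section Resolution

open Abelian

variable {A : Type u} [Ring A]

theorem ChainComplex.acyclic_augment {K : ChainComplex (ModuleCat.{u} A) ℕ} {M : ModuleCat.{u} A}
    {ε : K.X 0 ⟶ M} (w : K.d 1 0 ≫ ε = 0) (h₀ : ∀ x, ∃ y, ε y = x)
    (h₁ : ∀ x, ε x = 0 → ∃ y, K.d 1 0 y = x)
    (h₂ : ∀ n x, K.d (n + 1) n x = 0 → ∃ y, K.d (n + 2) (n + 1) y = x) :
    (K.augment ε w).Acyclic := by
  intro n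
  match n with
  | 0 =>
    rw [HomologicalComplex.exactAt_iff' _ 1 0 0 (by simp) (by simp),
      ShortComplex.moduleCat_exact_iff]
    exact fun x _ ↦ h₀ x
  | 1 =>
    rw [HomologicalComplex.exactAt_iff' _ 2 1 0 (by simp) (by simp),
      ShortComplex.moduleCat_exact_iff]
    exact h₁
  | n + 2 =>
    rw [HomologicalComplex.exactAt_iff' _ (n + 3) (n + 2) (n + 1) (by simp) (by simp),
      ShortComplex.moduleCat_exact_iff]
    exact h₂ n

theorem isRightGPAcyclic_augment {K : ChainComplex (ModuleCat.{u} A) ℕ} {M : ModuleCat.{u} A}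
    {ε : K.X 0 ⟶ M} (w : K.d 1 0 ≫ ε = 0)
    (h : ∀ X : ModuleCat.{u} A, IsGorensteinProjective X → (∀ f : X ⟶ M, ∃ g, g ≫ ε = f) ∧
      (∀ f : X ⟶ K.X 0, f ≫ ε = 0 → ∃ g, g ≫ K.d 1 0 = f) ∧
      ∀ (n) (f : X ⟶ K.X (n + 1)), f ≫ K.d (n + 1) n = 0 → ∃ g, g ≫ K.d (n + 2) (n + 1) = f) :
    IsRightGPAcyclic (K.augment ε w) := by
  intro X hX n
  obtain ⟨h₀, h₁, h₂⟩ := h X hX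
  match n with
  | 0 =>
    rw [HomologicalComplex.exactAt_iff' _ 1 0 0 (by simp) (by simp), ShortComplex.ab_exact_iff]
    exact fun f _ ↦ h₀ f
  | 1 =>
    rw [HomologicalComplex.exactAt_iff' _ 2 1 0 (by simp) (by simp), ShortComplex.ab_exact_iff]
    exact h₁
  | n + 2 =>
    rw [HomologicalComplex.exactAt_iff' _ (n + 3) (n + 2) (n + 1) (by simp) (by simp),
      ShortComplex.ab_exact_iff]
    exact h₂ n

theorem ProperGPResolution.isZero_ext_succ_iff {M : ModuleCat.{u} A} (R : ProperGPResolution M)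
    (N : ModuleCat.{u} A) (n : ℕ) : Limits.IsZero (R.ext (n + 1) N) ↔
      ∀ f : R.complex.X (n + 1) ⟶ N, R.complex.d (n + 1 + 1) (n + 1) ≫ f = 0 →
        ∃ g : R.complex.X n ⟶ N, R.complex.d (n + 1) n ≫ g = f := by
  rw [ProperGPResolution.ext, ← HomologicalComplex.exactAt_iff_isZero_homology,
    HomologicalComplex.exactAt_iff' _ n (n + 1) (n + 2) (by simp) (by simp),
    ShortComplex.moduleCat_exact_iff]
  rfl

/-- A cocycle on `G (n + 1)` factors through the syzygy `Z (n + 1)`, and a retraction of `i n`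
extends that factor to `G n`, so it is a coboundary. -/
theorem ProperGPResolution.exists_ofShortExact {Z G : ℕ → ModuleCat.{u} A}
    {i : ∀ n, Z (n + 1) ⟶ G n} {p : ∀ n, G n ⟶ Z n} {w : ∀ n, i n ≫ p n = 0}
    (hS : ∀ n, (ShortComplex.mk (i n) (p n) (w n)).ShortExact)
    (hG : ∀ n, IsGorensteinProjective (G n))
    (hp : ∀ (n : ℕ) (X : ModuleCat.{u} A), IsGorensteinProjective X → ∀ f : X ⟶ Z n,
      ∃ g : X ⟶ G n, g ≫ p n = f) :
    ∃ R : ProperGPResolution (Z 0), ∀ n, (∃ ρ : G n ⟶ Z (n + 1), i n ≫ ρ = 𝟙 _) →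
      ∀ N, Limits.IsZero (R.ext (n + 1) N) := by
  have sq (n : ℕ) : (p (n + 1 + 1) ≫ i (n + 1)) ≫ p (n + 1) ≫ i n = 0 := by
    rw [Category.assoc, reassoc_of% (w (n + 1)), Limits.zero_comp, Limits.comp_zero]
  -- The spliced complex is made opaque; only its objects and differentials are remembered.
  obtain ⟨K, hX, hd⟩ : ∃ (K : ChainComplex (ModuleCat.{u} A) ℕ) (e : K.X = G),
      ∀ n, K.d (n + 1) n = eqToHom (congrFun e (n + 1)) ≫ (p (n + 1) ≫ i n) ≫
        eqToHom (congrFun e n).symm :=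
    ⟨ChainComplex.of G (fun n ↦ p (n + 1) ≫ i n) sq, rfl, fun n ↦ by
      rw [eqToHom_refl, eqToHom_refl, Category.comp_id, Category.id_comp]
      exact ChainComplex.of_d_succ sq n⟩
  subst hX
  simp only [eqToHom_refl, Category.comp_id, Category.id_comp] at hd
  have hi (n : ℕ) : Mono (i n) := (hS n).mono_f
  have hpe (n : ℕ) : Epi (p n) := (hS n).epi_g
  have ex (n : ℕ) (x : K.X n) (hx : p n x = 0) : ∃ y, K.d (n + 1) n y = x := by
    obtain ⟨y, rfl⟩ := ModuleCat.exists_of_shortExact (hS n) hx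
    obtain ⟨z, rfl⟩ := ModuleCat.exists_apply_of_shortExact (hS (n + 1)) y
    exact ⟨z, by rw [hd]; rfl⟩
  have exl (n : ℕ) (X : ModuleCat.{u} A) (hX : IsGorensteinProjective X) (f : X ⟶ K.X n)
      (hf : f ≫ p n = 0) : ∃ g, g ≫ K.d (n + 1) n = f := by
    obtain ⟨g, hg⟩ := (hS n).exact.lift' f hf
    obtain ⟨g', rfl⟩ := hp (n + 1) X hX g
    exact ⟨g', by rw [hd, ← hg, Category.assoc]⟩
  have w₀ : K.d 1 0 ≫ p 0 = 0 := by
    rw [hd, Category.assoc, w, Limits.comp_zero]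
  refine ⟨⟨K, p 0, w₀, hG, ChainComplex.acyclic_augment w₀
    (ModuleCat.exists_apply_of_shortExact (hS 0)) (ex 0) fun n x hx ↦ ex (n + 1) x ?_,
    isRightGPAcyclic_augment w₀ fun X hX ↦ ⟨hp 0 X hX, exl 0 X hX, fun n f hf ↦
      exl (n + 1) X hX f ?_⟩⟩, fun n hn N ↦ ?_⟩
  · rw [hd] at hx
    exact ModuleCat.eq_zero_of_shortExact (hS n) hx
  · rw [hd] at hf
    rw [← cancel_mono (i n), Category.assoc, hf, Limits.zero_comp]
  · obtain ⟨ρ, hρ⟩ := hn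
    rw [ProperGPResolution.isZero_ext_succ_iff]
    intro f hf
    replace hf : K.d (n + 1 + 1) (n + 1) ≫ f = 0 := hf
    rw [hd, Category.assoc] at hf
    obtain ⟨g, rfl⟩ := (hS (n + 1)).exact.desc' f
      ((cancel_epi (p (n + 1 + 1))).1 (by rw [hf, Limits.comp_zero]))
    refine ⟨ρ ≫ g, ?_⟩
    change K.d (n + 1) n ≫ ρ ≫ g = _
    rw [hd, Category.assoc, reassoc_of% hρ]

/-- The `k`-th syzygy of an iterated special precover has no Ext into projectives above degree `n -
k`. From `k = n` on there is none in positive degrees, and the next kernel has finite projective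
dimension, so the sequence splits. -/
theorem exists_properGPResolution {n : ℕ}
    (hQ : ∀ Q : ModuleCat.{u} A, Projective Q → HasInjectiveDimensionLT Q (n + 1))
    (hI : ∀ J : ModuleCat.{u} A, Injective J → HasFiniteProjectiveDimension J)
    (M : ModuleCat.{u} A) : ∃ R : ProperGPResolution M,
      ∀ k, n < k → ∀ N, Limits.IsZero (R.ext k N) := by
  choose Y G i p w hS hY hG using exists_special_precover hQ hI
  let Z (k : ℕ) := Y^[k] M
  have hZ (k : ℕ) : Z (k + 1) = Y (Z k) := Function.iterate_succ_apply' Y k M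
  have hZY (k : ℕ) : HasFiniteProjectiveDimension (Z (k + 1)) := hZ k ▸ hY _
  have hses (k : ℕ) : ∃ (i : Z (k + 1) ⟶ G (Z k)) (p : G (Z k) ⟶ Z k) (w : i ≫ p = 0),
      (ShortComplex.mk i p w).ShortExact := by
    rw [hZ]
    exact ⟨i _, p _, w _, hS _⟩
  choose i p w hS using hses
  have hE (k : ℕ) : ExtProjVanishes (n - k) (Z k) := by
    induction k with
    | zero => exact .of_hasInjectiveDimensionLT hQ M
    | succ k ih =>
      exact .left (l := n - (k + 1)) (hS k) (fun Q h j hj ↦ hG _ Q h j (by lia)) ih (by lia)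
  obtain ⟨R, hR⟩ := ProperGPResolution.exists_ofShortExact hS
    (fun k ↦ (hG (Z k)).isGorensteinProjective hQ hI) (fun k X hX f ↦ (hS k).exists_lift X
      ((hZY k).subsingleton_ext hX.extProjVanishes 1 zero_lt_one) f)
  refine ⟨R, fun k hk N ↦ ?_⟩
  obtain ⟨k, rfl⟩ : ∃ j, k = j + 1 := ⟨k - 1, by lia⟩
  refine hR k ((hS k).exists_extension _ ?_ (𝟙 _)) N
  refine (hZY k).subsingleton_ext (X := Z k) ?_ 1 zero_lt_one
  have := hE k
  rwa [Nat.sub_eq_zero_of_le (by lia)] at this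

theorem gpDim_le_iff {M : ModuleCat.{u} A} (n : ℕ) : gpDim M ≤ n ↔
    ∃ R : ProperGPResolution M, ∀ k, n < k → ∀ N, Limits.IsZero (R.ext k N) := by
  refine ⟨fun h ↦ ?_, fun ⟨R, hR⟩ ↦ ?_⟩
  -- Without a proper resolution the infimum would be over an empty family, hence `⊤`.
  · obtain ⟨R⟩ : Nonempty (ProperGPResolution M) := by
      by_contra hne
      rw [not_nonempty_iff] at hne
      rw [gpDim, iInf_of_empty, top_le_iff] at h
      exact absurd (WithBot.coe_injective h) (ENat.natCast_ne_top n)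
    rw [gpDim_eq R] at h
    refine ⟨R, fun k hk N ↦ ?_⟩
    by_contra hN
    have := (le_iSup₂_of_le (f := fun (k : ℕ) (_ : ∃ N : ModuleCat.{u} A, ¬ Limits.IsZero (R.ext k N)) ↦
      (k : WithBot ℕ∞)) k ⟨N, hN⟩ le_rfl).trans h
    have : k ≤ n := by exact_mod_cast this
    lia
  · rw [gpDim_eq R]
    refine iSup₂_le fun k ⟨N, hN⟩ ↦ ?_
    by_contra hk
    refine hN (hR k ?_ N)
    rw [not_le] at hk
    exact_mod_cast hk

end Resolution

/-! ### Consequences of finite Gorenstein-projective dimension. -/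

section Resolution

open Abelian

variable {A : Type u} [Ring A]

theorem ProperGPResolution.exists_shortExact {M : ModuleCat.{u} A} (R : ProperGPResolution M) :
    ∃ (Z G : ℕ → ModuleCat.{u} A) (i : ∀ n, Z (n + 1) ⟶ G n) (p : ∀ n, G n ⟶ Z n)
      (w : ∀ n, i n ≫ p n = 0), Nonempty (Z 0 ≅ M) ∧ (∀ n, IsGorensteinProjective (G n)) ∧
      (∀ n, (ShortComplex.mk (i n) (p n) (w n)).ShortExact) ∧
      ∀ n, (∀ N, Limits.IsZero (R.ext (n + 1) N)) → ∃ ρ : G n ⟶ Z (n + 1), i n ≫ ρ = 𝟙 _ := by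
  let C := R.complex.augment R.ε R.d_comp_ε
  have hC : C.Acyclic := R.acyclic
  have hS (n : ℕ) : (ShortComplex.mk (C.iCycles (n + 1)) (C.toCycles (n + 1) n)
      (by rw [← cancel_mono (C.iCycles n)]; simp)).ShortExact := by
    refine { exact := ?_, mono_f := inferInstanceAs (Mono (C.iCycles _)), epi_g := ?_ }
    · exact ShortComplex.exact_of_f_is_kernel _ (Limits.isKernelOfComp (C.iCycles n) _
        (C.cyclesIsKernel (n + 1) n (by simp)) _ (by simp))
    · exact Preadditive.epi_of_isZero_cokernel' _ (C.homologyIsCokernel (n + 1) n (by simp))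
        ((C.exactAt_iff_isZero_homology n).1 (hC n))
  -- Augmentation puts `M` in degree `0` and `G n` in degree `n + 1`, so the zeroth cycles are `M`.
  have : IsIso (C.iCycles 0) := C.isIso_iCycles 0 _ rfl (C.shape _ _ (by simp))
  have e : C.cycles 0 ≅ C.X 0 := asIso (C.iCycles 0)
  refine ⟨fun n ↦ C.cycles n, fun n ↦ R.complex.X n, fun n ↦ C.iCycles (n + 1),
    fun n ↦ C.toCycles (n + 1) n, _, ⟨e⟩,
    R.gorensteinProjective, hS, fun n hn ↦ ?_⟩
  have := (hS (n + 1)).epi_g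
  have hw : C.d (n + 1 + 1 + 1) (n + 1 + 1) ≫ C.toCycles (n + 1 + 1) (n + 1) = 0 := by
    rw [← cancel_mono (C.iCycles (n + 1))]
    simp
  -- Vanishing is applied to the universal cocycle, the projection onto the syzygy; its primitive is
  -- the required retraction.
  obtain ⟨g, hg⟩ := (R.isZero_ext_succ_iff (C.cycles (n + 1)) n).1 (hn _)
    (C.toCycles (n + 1 + 1) (n + 1)) hw
  replace hg : C.d (n + 1 + 1) (n + 1) ≫ g = C.toCycles (n + 1 + 1) (n + 1) := hg
  refine ⟨g, (cancel_epi (C.toCycles (n + 1 + 1) (n + 1))).1 ?_⟩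
  exact (C.toCycles_i_assoc (n + 1 + 1) (n + 1) g).trans (hg.trans (Category.comp_id _).symm)

theorem IsGorensteinProjective.of_shortExact_retract {K G M : ModuleCat.{u} A} {i : K ⟶ G}
    {p : G ⟶ M} {w : i ≫ p = 0} (hS : (ShortComplex.mk i p w).ShortExact)
    (hG : IsGorensteinProjective G) {ρ : G ⟶ K} (hρ : i ≫ ρ = 𝟙 _) :
    IsGorensteinProjective M := by
  have := hS.epi_g
  let s := ShortComplex.Splitting.ofExactOfRetraction _ hS.exact ρ hρ this
  exact IsGPSummand.isGorensteinProjective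
    ⟨K, hG.of_iso (s.isoBinaryBiproduct ≪≫ Limits.biprod.braiding K M)⟩

/-- Induction along a Gorenstein-projective resolution of finite length. -/
theorem gpDim_induction {P : ℕ → ModuleCat.{u} A → Prop}
    (iso : ∀ (n) (M N : ModuleCat.{u} A), (M ≅ N) → P n M → P n N)
    (zero : ∀ M, IsGorensteinProjective M → P 0 M)
    (succ : ∀ (n) (K G M : ModuleCat.{u} A) (i : K ⟶ G) (p : G ⟶ M) (w : i ≫ p = 0),
      (ShortComplex.mk i p w).ShortExact → IsGorensteinProjective G → P n K → P (n + 1) M)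
    {n : ℕ} {M : ModuleCat.{u} A} (hM : gpDim M ≤ n) : P n M := by
  obtain ⟨R, hR⟩ := (gpDim_le_iff n).1 hM
  obtain ⟨Z, G, i, p, w, ⟨e⟩, hG, hS, h⟩ := R.exists_shortExact
  suffices H : ∀ k j, j + k = n → P k (Z j) from iso _ _ _ e (H n 0 (zero_add n))
  intro k
  induction k with
  | zero =>
    -- At the last stage Ext vanishing splits the sequence, so `Z j` is a summand of `G j`.
    rintro j rfl
    obtain ⟨ρ, hρ⟩ := h j (hR (j + 1) (by lia))
    exact zero _ (.of_shortExact_retract (hS j) (hG j) hρ)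
  | succ k ih => exact fun j hj ↦ succ k _ _ _ _ _ _ (hS j) (hG j) (ih (j + 1) (by lia))

theorem ExtProjVanishes.of_gpDim_le {n : ℕ} {M : ModuleCat.{u} A} (hM : gpDim M ≤ n) :
    ExtProjVanishes n M := by
  refine gpDim_induction (fun n M N e h ↦ h.retract (Retract.ofIso e.symm))
    (fun M h ↦ h.extProjVanishes) (fun n K G M i p w hS hG hK Q hQ k hk ↦ ?_) hM
  obtain ⟨k, rfl⟩ : ∃ j, k = j + 1 := ⟨k - 1, by lia⟩
  exact hS.subsingleton_ext_X₃ Q k (hK Q hQ k (by lia)) (hG.extProjVanishes Q hQ _ (by lia))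

/-- For `K → G → M` and `K → Y → C`, the pushout `W` is an extension of `C` by `G`, hence
Gorenstein-projective, and embeds in a projective `Q`. Then `M = W / Y` embeds in `Q / Y`, which has
finite projective dimension. -/
theorem exists_shortExact_finiteProjectiveDimension {n : ℕ} {M : ModuleCat.{u} A}
    (hM : gpDim M ≤ n) : ∃ (Y C : ModuleCat.{u} A) (i : M ⟶ Y) (p : Y ⟶ C) (w : i ≫ p = 0),
      (ShortComplex.mk i p w).ShortExact ∧ HasFiniteProjectiveDimension Y ∧
        IsGorensteinProjective C := by
  refine gpDim_induction (P := fun _ M ↦ ∃ (Y C : ModuleCat.{u} A) (i : M ⟶ Y) (p : Y ⟶ C)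
    (w : i ≫ p = 0), (ShortComplex.mk i p w).ShortExact ∧ HasFiniteProjectiveDimension Y ∧
      IsGorensteinProjective C) ?_ (fun M hM ↦ ?_) ?_ hM
  · rintro n M N e ⟨Y, C, i, p, w, hS, hY, hC⟩
    exact ⟨Y, C, _, p, _, hS.comp_iso e.symm, hY, hC⟩
  · obtain ⟨Q, C, i, p, w, hQ, hC, hS⟩ := hM.exists_shortExact
    exact ⟨Q, C, i, p, w, hS, .of_projective hQ, hC⟩
  · rintro n K G M i p w hS hG ⟨Y, C, i', p', w', hS', hY, hC⟩
    obtain ⟨W, a, b, q, r, h, h', h₁, h₂⟩ := ModuleCat.exists_pushout hS hS'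
    obtain ⟨Q, C', j, t, v, hQ, hC', hT⟩ := (hG.ext h₂ hC).exists_shortExact
    obtain ⟨Y', π, m, s, h, h', h₃, h₄⟩ := ModuleCat.exists_shortExact_comp_mono h₁ hT
    exact ⟨Y', C', m, s, h', h₄, .right h₃ hY (.of_projective hQ), hC'⟩

section GlobalDimension

variable {n : ℕ} (hA : globalGPDim A ≤ n)

include hA

theorem gpDim_le_of_globalGPDim_le (M : ModuleCat.{u} A) : gpDim M ≤ n :=
  (le_iSup gpDim M).trans hA

theorem hasInjectiveDimensionLT_of_globalGPDim_le (Q : ModuleCat.{u} A) (hQ : Projective Q) :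
    HasInjectiveDimensionLT Q (n + 1) :=
  hasInjectiveDimensionLT_of_enoughProjectives Q (n + 1) fun M ↦
    ExtProjVanishes.of_gpDim_le (gpDim_le_of_globalGPDim_le hA M) Q hQ _ (by lia)

theorem hasProjectiveDimensionLT_of_globalGPDim_le (J : ModuleCat.{u} A) (hJ : Injective J) :
    HasProjectiveDimensionLT J (n + 1) := by
  have hn := gpDim_le_of_globalGPDim_le hA J
  obtain ⟨Y, C, i, p, w, hS, hY, -⟩ := exists_shortExact_finiteProjectiveDimension hn
  have := hS.mono_f
  refine (hY.retract ⟨i, Injective.factorThru (𝟙 J) i, Injective.comp_factorThru _ _⟩)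
    |>.hasProjectiveDimensionLT (.of_gpDim_le hn)

end GlobalDimension

theorem globalGPDim_le {n : ℕ}
    (hQ : ∀ Q : ModuleCat.{u} A, Projective Q → HasInjectiveDimensionLT Q (n + 1))
    (hI : ∀ J : ModuleCat.{u} A, Injective J → HasFiniteProjectiveDimension J) :
    globalGPDim A ≤ n :=
  iSup_le fun M ↦ (gpDim_le_iff n).2 (exists_properGPResolution hQ hI M)

theorem WithBot.exists_le_natCast {x : WithBot ℕ∞} (h : x < ⊤) : ∃ d : ℕ, x ≤ d := by
  induction x with
  | bot => exact ⟨0, bot_le⟩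
  | coe x =>
    induction x with
    | top => exact absurd h (lt_irrefl _)
    | coe n => exact ⟨n, le_rfl⟩

/-- Natural-number bounds cannot separate `⊥` from `0`, so the degenerate case is settled apart.
Finiteness supplies the proper resolutions. -/
theorem globalGPDim_eq_bot_iff (h : globalGPDim A < ⊤) : globalGPDim A = ⊥ ↔ Subsingleton A := by
  refine ⟨fun hA ↦ ?_, fun hA ↦ ?_⟩
  · by_contra hne
    have hbot : gpDim (ModuleCat.of A A) = ⊥ := le_bot_iff.1 (hA ▸ le_iSup gpDim _)
    obtain ⟨R, -⟩ := (gpDim_le_iff 0).1 (hbot.trans_le bot_le)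
    rw [gpDim_eq R, iSup₂_eq_bot] at hbot
    by_cases h0 : ∃ N, ¬ Limits.IsZero (R.ext 0 N)
    · exact absurd (hbot 0 h0) (by simp)
    · push Not at h0
      have := h0 (ModuleCat.of A A)
      rw [ProperGPResolution.ext, isZero_homology_linearYonedaObj_iff] at this
      obtain ⟨g, hg⟩ := this R.ε R.d_comp_ε
      -- In degree `0` there is no incoming differential, so vanishing cohomology forces the cocycle
      -- `ε` itself to be zero, although it hits `1`.
      rw [R.complex.shape 0 _ (by simp), Limits.zero_comp] at hg
      have hac := R.acyclic 0
      rw [HomologicalComplex.exactAt_iff' _ 1 0 0 (by simp) (by simp),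
        ShortComplex.moduleCat_exact_iff] at hac
      obtain ⟨x, hx⟩ := hac (1 : A) rfl
      replace hx : R.ε x = (1 : A) := hx
      rw [← hg] at hx
      exact hne (subsingleton_of_zero_eq_one hx)
  · refine le_bot_iff.1 (iSup_le fun M ↦ ?_)
    obtain ⟨d, hd⟩ := WithBot.exists_le_natCast h
    obtain ⟨R, -⟩ := (gpDim_le_iff d).1 (gpDim_le_of_globalGPDim_le hd M)
    rw [gpDim_eq R]
    refine iSup₂_le fun k ⟨N, hN⟩ ↦ absurd ?_ hN
    rw [ProperGPResolution.ext, isZero_homology_linearYonedaObj_iff]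
    have : Subsingleton N := Module.subsingleton A N
    exact fun f _ ↦ ⟨0, by ext x; exact Subsingleton.elim _ _⟩

end Resolution

/-! ### Assembly over an artin algebra. -/

section Main

theorem injectiveDimension_op_eq (A : Type u) [Ring A] :
    injectiveDimension (ModuleCat.of Aᵐᵒᵖ A) = injectiveDimension (ModuleCat.of Aᵐᵒᵖ Aᵐᵒᵖ) :=
  ModuleCat.injectiveDimension_eq_of_linearEquiv
    { MulOpposite.opAddEquiv with map_smul' := fun _ _ ↦ rfl }

section Noetherian

variable {A : Type u} [Ring A] {k : ℕ}

theorem hasInjectiveDimensionLT_self_of_globalGPDim_le (h : globalGPDim A ≤ k) :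
    HasInjectiveDimensionLT (ModuleCat.of A A) (k + 1) :=
  hasInjectiveDimensionLT_of_globalGPDim_le h _
    (ModuleCat.projective_of_free (Module.Basis.singleton PUnit.{u + 1} A))

variable [IsNoetherianRing Aᵐᵒᵖ]

theorem hasInjectiveDimensionLT_op_of_globalGPDim_le (h : globalGPDim A ≤ k) :
    HasInjectiveDimensionLT (ModuleCat.of Aᵐᵒᵖ Aᵐᵒᵖ) (k + 1) :=
  CharDual.hasInjectiveDimensionLT_of_injective (τ := RingEquiv.refl Aᵐᵒᵖ)
    (τ' := RingEquiv.opOp A) (fun _ ↦ rfl) (fun _ ↦ rfl) k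
    (hasProjectiveDimensionLT_of_globalGPDim_le h)

variable [IsSemiprimaryRing A]

theorem hasProjectiveDimensionLT_of_op
    (h : HasInjectiveDimensionLT (ModuleCat.of Aᵐᵒᵖ Aᵐᵒᵖ) (k + 1)) (J : ModuleCat.{u} A)
    (hJ : Injective J) : HasProjectiveDimensionLT J (k + 1) :=
  CharDual.hasProjectiveDimensionLT_of_injective (τ := RingEquiv.refl Aᵐᵒᵖ)
    (τ' := RingEquiv.opOp A) (fun _ ↦ rfl) (fun _ ↦ rfl) k h J hJ

variable [IsNoetherianRing A]

theorem globalGPDim_le_of_hasInjectiveDimensionLT {m : ℕ}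
    (h : HasInjectiveDimensionLT (ModuleCat.of A A) (k + 1))
    (h' : HasInjectiveDimensionLT (ModuleCat.of Aᵐᵒᵖ Aᵐᵒᵖ) (m + 1)) : globalGPDim A ≤ k :=
  globalGPDim_le (hasInjectiveDimensionLT_of_projective k h) fun J hJ ↦
    ⟨m, hasProjectiveDimensionLT_of_op h' J hJ⟩

end Noetherian

theorem WithBot.eq_of_forall_le_natCast_iff {x y : WithBot ℕ∞} (hbot : x = ⊥ ↔ y = ⊥)
    (h : ∀ n : ℕ, x ≤ n ↔ y ≤ n) : x = y := by
  refine eq_of_forall_ge_iff fun z ↦ ?_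
  induction z with
  | bot => simpa using hbot
  | coe z =>
    induction z with
    | top => exact iff_of_true le_top le_top
    | coe n => exact h n

end Main

theorem mainTheorem8 {R : Type*} [CommRing R] [IsArtinianRing R]
    (A : Type u) [Ring A] [Algebra R A] [Module.Finite R A] :
    (IsGorensteinAlgebra A ↔ globalGPDim A < ⊤) ∧
      (IsGorensteinAlgebra A →
        injectiveDimension (ModuleCat.of A A) = globalGPDim A ∧
          injectiveDimension (ModuleCat.of Aᵐᵒᵖ A) = globalGPDim A) := by
  have : Module.Finite R Aᵐᵒᵖ := Module.Finite.equiv (MulOpposite.opLinearEquiv R)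
  have := IsArtinianRing.of_finite R A
  have := IsArtinianRing.of_finite R Aᵐᵒᵖ
  have hlt (x : WithBot ℕ∞) (k : ℕ) (h : x ≤ k) : x < ⊤ :=
    h.trans_lt (WithBot.coe_lt_coe.2 (ENat.natCast_lt_top k))
  have hA (k : ℕ) : injectiveDimension (ModuleCat.of A A) ≤ k ↔
    HasInjectiveDimensionLT (ModuleCat.of A A) (k + 1) := injectiveDimension_le_iff _ k
  have hB (k : ℕ) : injectiveDimension (ModuleCat.of Aᵐᵒᵖ A) ≤ k ↔
      HasInjectiveDimensionLT (ModuleCat.of Aᵐᵒᵖ Aᵐᵒᵖ) (k + 1) := by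
    rw [injectiveDimension_op_eq]
    exact injectiveDimension_le_iff _ k
  have H : IsGorensteinAlgebra A ↔ globalGPDim A < ⊤ := by
    refine ⟨fun ⟨h, h'⟩ ↦ ?_, fun h ↦ ?_⟩
    · obtain ⟨k, hk⟩ := WithBot.exists_le_natCast h
      obtain ⟨m, hm⟩ := WithBot.exists_le_natCast h'
      exact hlt _ k (globalGPDim_le_of_hasInjectiveDimensionLT ((hA k).1 hk) ((hB m).1 hm))
    · obtain ⟨k, hk⟩ := WithBot.exists_le_natCast h
      exact ⟨hlt _ k ((hA k).2 (hasInjectiveDimensionLT_self_of_globalGPDim_le hk)),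
        hlt _ k ((hB k).2 (hasInjectiveDimensionLT_op_of_globalGPDim_le hk))⟩
  refine ⟨H, fun hG ↦ ?_⟩
  have hbot := globalGPDim_eq_bot_iff (H.1 hG)
  obtain ⟨m, hm⟩ := WithBot.exists_le_natCast hG.1
  obtain ⟨m', hm'⟩ := WithBot.exists_le_natCast hG.2
  refine ⟨WithBot.eq_of_forall_le_natCast_iff ?_ fun k ↦ ⟨fun hk ↦ ?_, fun hk ↦ ?_⟩,
    WithBot.eq_of_forall_le_natCast_iff ?_ fun k ↦ ⟨fun hk ↦ ?_, fun hk ↦ ?_⟩⟩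
  · rw [injectiveDimension_eq_bot_iff, ModuleCat.isZero_iff_subsingleton, hbot]
  -- The bound `k` comes from the left side alone; on the right only finiteness is used.
  · exact globalGPDim_le_of_hasInjectiveDimensionLT ((hA k).1 hk) ((hB m').1 hm')
  · exact (hA k).2 (hasInjectiveDimensionLT_self_of_globalGPDim_le hk)
  · rw [injectiveDimension_eq_bot_iff, ModuleCat.isZero_iff_subsingleton, hbot]
  -- The right bound `k` bounds the projective dimension of injective left modules, which forces the
  -- left injective dimension, known to be finite, down to at most `k`.
  · exact globalGPDim_le_of_hasInjectiveDimensionLT (hasInjectiveDimensionLT_of_injective_bound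
      (hasProjectiveDimensionLT_of_op ((hB k).1 hk)) _ m ((hA m).1 hm)) ((hB k).1 hk)
  · exact (hB k).2 (hasInjectiveDimensionLT_op_of_globalGPDim_le hk)
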